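/- Let $\mathcal{H}$ be a separable complex Hilbert space and let $\mathcal{A}\subseteq\mathcal{B}(\mathcal{H})$ be a von Neumann algebra (a unital $*$-subalgebra equal to its double commutant). Projections are orthogonal projections, with their usual order. Projections $P,Q\in\mathcal{A}$ are equivalent if there is $V\in\mathcal{A}$ with $V^*V=P$ and $VV^*=Q$; $P\in\mathcal A$ is infinite if it is equivalent to some projection $Q\in\mathcal{A}$ with $Q\lneq P$, and finite otherwise; a nonzero $P\in\mathcal A$ is minimal if there is no nonzero projection $Q\in\mathcal{A}$ with $Q\lneq P$. $\mathcal{A}$ is a factor if $\mathcal{A}\cap\mathcal{A}'=\mathbb{C}1$; a factor is of type II if it contains a nonzero finite projection but no minimal projection; a type II factor is of type II$_1$ if all its projections are finite, and of type II$_\infty$ if it contains an infinite projection. Let $\mathcal{A}$ be a type II$_\infty$ factor on $\mathcal{H}$. Then $\mathcal{A}$ contains a nonzero finite projection, and for every nonzero finite projection $P\in\mathcal{A}$: 1. the algebra $P\mathcal{A}P=\{PTP : T\in\mathcal{A}\}$, considered as an algebra of operators on the Hilbert space $P\mathcal{H}$, is a von Neumann algebra and is a type II$_1$ factor; 2. there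 are an infinite-dimensional separable Hilbert space $\mathcal{H}'$ and a unitary $U:\mathcal{H}\to\mathcal{H}'\otimes P\mathcal{H}$ such that $$U\mathcal{A}U^*=\mathcal{B}(\mathcal{H}')\otimes P\mathcal{A}P .$$ Here $\mathcal{H}'\otimes P\mathcal{H}$ is the Hilbert space tensor product, and $\mathcal{B}(\mathcal{H}')\otimes P\mathcal{A}P$ is the von Neumann algebra on it generated by the operators $a\otimes b$ with $a\in\mathcal{B}(\mathcal{H}')$ and $b\in P\mathcal{A}P$. -/

import Mathlib

open scoped TensorProduct

universe u v

namespace VNFactor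

section Projections

variable {H : Type u} [NormedAddCommGroup H] [InnerProductSpace ℂ H] [CompleteSpace H]

/-- `P` is an orthogonal projection belonging to the von Neumann algebra `A`. -/
def IsProj (A : VonNeumannAlgebra H) (P : H →L[ℂ] H) : Prop :=
  P ∈ A ∧ IsStarProjection P

/-- Equivalence of projections relative to `A`: there is a (necessarily partial isometry) `V ∈ A`
with `V* V = P` and `V V* = Q`. -/
def Equivalent (A : VonNeumannAlgebra H) (P Q : H →L[ℂ] H) : Prop :=
  ∃ V ∈ A, star V * V = P ∧ V * star V = Q

/-- `P` is a finite projection of `A`: no proper subprojection of `P` in `A` is equivalent to `P`.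
Here `Q < P` refers to the usual (Loewner) order of operators. -/
def IsFiniteProj (A : VonNeumannAlgebra H) (P : H →L[ℂ] H) : Prop :=
  IsProj A P ∧ ∀ Q, IsProj A Q → Q < P → ¬ Equivalent A Q P

/-- `P` is an infinite projection of `A`: it is equivalent to a proper subprojection in `A`. -/
def IsInfiniteProj (A : VonNeumannAlgebra H) (P : H →L[ℂ] H) : Prop :=
  IsProj A P ∧ ∃ Q, IsProj A Q ∧ Q < P ∧ Equivalent A Q P

/-- `P` is a nonzero minimal projection of `A`: it has no nonzero proper subprojection in `A`. -/
def IsMinimalProj (A : VonNeumannAlgebra H) (P : H →L[ℂ] H) : Prop :=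
  IsProj A P ∧ P ≠ 0 ∧ ∀ Q, IsProj A Q → Q < P → Q = 0

/-- A factor: the centre `A ∩ A'` consists of the scalar multiples of the identity. -/
def IsFactor (A : VonNeumannAlgebra H) : Prop :=
  ∀ T ∈ A, T ∈ A.commutant → ∃ c : ℂ, T = c • (1 : H →L[ℂ] H)

/-- A type II factor: there are nonzero finite projections, but no nonzero minimal projections. -/
def IsFactorII (A : VonNeumannAlgebra H) : Prop :=
  IsFactor A ∧ (∃ P, IsFiniteProj A P ∧ P ≠ 0) ∧ ¬ ∃ P, IsMinimalProj A P

/-- A type II₁ factor: a type II factor all of whose projections are finite. -/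
def IsFactorIIOne (A : VonNeumannAlgebra H) : Prop :=
  IsFactorII A ∧ ∀ P, IsProj A P → IsFiniteProj A P

/-- A type II∞ factor: a type II factor that contains an infinite projection. -/
def IsFactorIIInfty (A : VonNeumannAlgebra H) : Prop :=
  IsFactorII A ∧ ∃ P, IsInfiniteProj A P

end Projections

section Corner

variable {H : Type u} [NormedAddCommGroup H] [InnerProductSpace ℂ H]

/-- The subspace `PH` of a projection `P`, written as the space of vectors with `P x = x`, so that
it is visibly closed. -/
def projSpace (P : H →L[ℂ] H) : Submodule ℂ H :=
  LinearMap.ker ((1 - P : H →L[ℂ] H) : H →ₗ[ℂ] H)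

theorem mem_projSpace {P : H →L[ℂ] H} {x : H} : x ∈ projSpace P ↔ P x = x := by
  change x - P x = 0 ↔ P x = x
  rw [sub_eq_zero, eq_comm]

theorem projSpace_eq_range {P : H →L[ℂ] H} (hP : IsIdempotentElem P) :
    projSpace P = LinearMap.range (P : H →ₗ[ℂ] H) := by
  ext x
  rw [mem_projSpace]
  constructor
  · intro h
    exact ⟨x, h⟩
  · rintro ⟨y, rfl⟩
    exact congrArg (fun T : H →L[ℂ] H => T y) hP

theorem isClosed_projSpace (P : H →L[ℂ] H) : IsClosed (projSpace P : Set H) :=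
  ContinuousLinearMap.isClosed_ker (1 - P)

instance instCompleteSpaceProjSpace [CompleteSpace H] (P : H →L[ℂ] H) :
    CompleteSpace (projSpace P) :=
  (isClosed_projSpace P).completeSpace_coe

/-- The algebra `P A P` considered as a set of operators on the Hilbert space `PH`: the
restrictions to `PH` of the operators `P T P` with `T ∈ A`. -/
def corner [CompleteSpace H] (A : VonNeumannAlgebra H) (P : H →L[ℂ] H) :
    Set (projSpace P →L[ℂ] projSpace P) :=
  {S | ∃ T ∈ A, ∀ x : projSpace P, (S x : H) = P (T (P x))}

end Corner

section Algebras

variable {H : Type u} [NormedAddCommGroup H] [InnerProductSpace ℂ H] [CompleteSpace H]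

/-- The von Neumann algebra generated by a set `S` of operators: the double commutant of
`S ∪ S*`. -/
noncomputable def generated (S : Set (H →L[ℂ] H)) : VonNeumannAlgebra H where
  toStarSubalgebra := StarSubalgebra.centralizer ℂ (Set.centralizer (S ∪ star S))
  centralizer_centralizer' := by
    change Set.centralizer (Set.centralizer
      (StarSubalgebra.centralizer ℂ (Set.centralizer (S ∪ star S)) : Set (H →L[ℂ] H))) =
      (StarSubalgebra.centralizer ℂ (Set.centralizer (S ∪ star S)) : Set (H →L[ℂ] H))
    rw [StarSubalgebra.coe_centralizer, Set.centralizer_centralizer_centralizer]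

theorem coe_generated (S : Set (H →L[ℂ] H)) :
    (generated S : Set (H →L[ℂ] H)) = Set.centralizer (Set.centralizer (S ∪ star S)) := by
  have h : star (Set.centralizer (S ∪ star S)) = Set.centralizer (S ∪ star S) := by
    rw [Set.star_centralizer, Set.union_star, star_star, Set.union_comm]
  change (StarSubalgebra.centralizer ℂ (Set.centralizer (S ∪ star S)) : Set (H →L[ℂ] H)) = _
  rw [StarSubalgebra.coe_centralizer, h, Set.union_self]

variable (H) in
/-- The algebra `B(H)` of all bounded operators on `H`, as a von Neumann algebra. -/
noncomputable def allOperators : VonNeumannAlgebra H where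
  toStarSubalgebra := ⊤
  centralizer_centralizer' := by
    change Set.centralizer (Set.centralizer (Set.univ : Set (H →L[ℂ] H))) = Set.univ
    rw [Set.centralizer_univ, Set.eq_univ_iff_forall]
    exact fun T => Set.mem_centralizer_iff.mpr fun c hc => (Set.mem_center_iff.mp hc).comm T

theorem mem_allOperators (T : H →L[ℂ] H) : T ∈ allOperators H := Set.mem_univ T

end Algebras

section Tensor

variable {H : Type u} [NormedAddCommGroup H] [InnerProductSpace ℂ H]
variable {K : Type v} [NormedAddCommGroup K] [InnerProductSpace ℂ K]

variable (H K) in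
/-- The Hilbert space tensor product: the completion of the algebraic tensor product in the inner
product with `⟪a ⊗ b, c ⊗ d⟫ = ⟪a, c⟫ ⟪b, d⟫`. -/
abbrev HilbertTensor : Type (max u v) := UniformSpace.Completion (H ⊗[ℂ] K)

/-- The bounded operator `a ⊗ b` on the Hilbert space tensor product. -/
noncomputable def opTensor (a : H →L[ℂ] H) (b : K →L[ℂ] K) :
    HilbertTensor H K →L[ℂ] HilbertTensor H K :=
  (TensorProduct.mapL a b).completion

theorem opTensor_tmul (a : H →L[ℂ] H) (b : K →L[ℂ] K) (x : H) (y : K) :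
    opTensor a b ((x ⊗ₜ[ℂ] y : H ⊗[ℂ] K) : HilbertTensor H K) =
      ((a x ⊗ₜ[ℂ] b y : H ⊗[ℂ] K) : HilbertTensor H K) := by
  simp [opTensor]

/-- The tensor product of von Neumann algebras: the von Neumann algebra on the Hilbert space
tensor product generated by the operators `a ⊗ b` with `a ∈ A`, `b ∈ B`. -/
noncomputable def tensor [CompleteSpace H] [CompleteSpace K]
    (A : VonNeumannAlgebra H) (B : VonNeumannAlgebra K) :
    VonNeumannAlgebra (HilbertTensor H K) :=
  generated {T | ∃ a ∈ A, ∃ b ∈ B, T = opTensor a b}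

/-- Unitary equivalence (spatial isomorphism) of von Neumann algebras: `U A U* = B` for some
unitary `U : H → K`. -/
def UnitarilyEquivalent [CompleteSpace H] [CompleteSpace K]
    (A : VonNeumannAlgebra H) (B : VonNeumannAlgebra K) : Prop :=
  ∃ U : H ≃ₗᵢ[ℂ] K,
    (fun T : H →L[ℂ] H =>
      (U : H →L[ℂ] K) ∘L T ∘L (U.symm : K →L[ℂ] H)) '' (A : Set (H →L[ℂ] H)) =
    (B : Set (K →L[ℂ] K))

end Tensor

end VNFactor

/-!
A type II∞ factor `A` is an infinite amplification of the corner `P A P` of any nonzero finite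
projection `P ∈ A`.

The reason is that the identity is a strong sum `∑ X i (X i)*` over an infinite index set with
`X i ∈ A` and `(X i)* X j = δ i j P` (`IsFactor.exists_total_copies`). Comparison of projections
(`IsFactor.comparison`) follows from Zorn's lemma and the polar decomposition. An infinite
projection makes the identity equivalent to a proper subprojection, hence provides infinitely many
orthogonal copies of some nonzero projection. Grouping these into infinitely many rows gives
orthogonal infinite projections, each of which dominates a copy of the finite projection `P`. A
maximal family of orthogonal copies of `P` is therefore infinite when it extends this one, and the
complement of its sum is equivalent to a part of `P`; a Hilbert hotel argument absorbs that
complement into the family.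

The corner is the commutant of the compression of `A'` to `PH` (`coe_cornerAlgebra`), so it is a von
Neumann algebra; the absence of minimal projections and the finiteness of all projections are
inherited from `A` and `P`. Given an orthonormal basis `e i` of a Hilbert space `K`, the unitary
`X i y ↦ e i ⊗ y` carries `T' ∈ A'` to `1 ⊗ T'|PH`, so by the double commutant property every
operator of `B(K) ⊗ P A P` comes from `A` (`conj_adjoint_mem`). Conversely the matrix entries
`(X i)* T X j` of `T ∈ A` are in the corner (`conj_mem_tensor`). Finally, a central element `Z` of
the corner gives the central element `1 ⊗ Z` of the amplification, so the corner is a factor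
(`isFactor_cornerAlgebra`).
-/

namespace VNFactor

open scoped InnerProduct InnerProductSpace

/-! ### Strong sums of orthogonal partial isometries -/

section StrongSums

variable {ι : Type*} {E F : Type*} [NormedAddCommGroup E] [InnerProductSpace ℂ E] [CompleteSpace E]
  [NormedAddCommGroup F] [InnerProductSpace ℂ F] [CompleteSpace F]

/-- A family of partial isometries whose initial spaces are mutually orthogonal and whose final
spaces are mutually orthogonal. -/
structure OrthoPartialIsometries (V : ι → E →L[ℂ] F) : Prop where
  partialIsometry : ∀ i, V i ∘L (V i)† ∘L V i = V i
  comp_adjoint : ∀ i j, i ≠ j → V i ∘L (V j)† = 0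
  adjoint_comp : ∀ i j, i ≠ j → (V i)† ∘L V j = 0

namespace OrthoPartialIsometries

variable {V : ι → E →L[ℂ] F}

theorem adjoint (h : OrthoPartialIsometries V) :
    OrthoPartialIsometries fun i => (V i)† where
  partialIsometry i := by
    have := congrArg ContinuousLinearMap.adjoint (h.partialIsometry i)
    simpa [ContinuousLinearMap.adjoint_comp, ContinuousLinearMap.comp_assoc] using this
  comp_adjoint i j hij := by simpa using h.adjoint_comp i j hij
  adjoint_comp i j hij := by simpa using h.comp_adjoint i j hij

theorem inner_eq_zero (h : OrthoPartialIsometries V) {i j : ι} (hij : i ≠ j) (x y : E) :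
    ⟪V i x, V j y⟫_ℂ = 0 := by
  rw [← ContinuousLinearMap.adjoint_inner_right]
  have := DFunLike.congr_fun (h.adjoint_comp i j hij) y
  simp only [ContinuousLinearMap.comp_apply] at this
  simp [this]

theorem orthogonalFamily (h : OrthoPartialIsometries V) :
    OrthogonalFamily ℂ (fun i => LinearMap.range (V i : E →ₗ[ℂ] F))
      fun i => (LinearMap.range (V i : E →ₗ[ℂ] F)).subtypeₗᵢ := by
  rintro i j hij ⟨_, x, rfl⟩ ⟨_, y, rfl⟩
  exact h.inner_eq_zero hij x y

theorem norm_sum_sq (h : OrthoPartialIsometries V) (s : Finset ι) (x : E) :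
    ‖∑ i ∈ s, V i x‖ ^ 2 = ∑ i ∈ s, ‖V i x‖ ^ 2 :=
  h.orthogonalFamily.norm_sum (fun i => ⟨V i x, x, rfl⟩) s

theorem norm_adjoint_apply_apply (h : OrthoPartialIsometries V) (i : ι) (x : E) :
    ‖((V i)†) (V i x)‖ ^ 2 = ‖V i x‖ ^ 2 := by
  have hp := DFunLike.congr_fun (h.partialIsometry i) x
  simp only [ContinuousLinearMap.comp_apply] at hp
  have : ⟪((V i)†) (V i x), ((V i)†) (V i x)⟫_ℂ
      = ⟪V i x, V i x⟫_ℂ := by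
    rw [ContinuousLinearMap.adjoint_inner_left, hp]
  rw [inner_self_eq_norm_sq_to_K, inner_self_eq_norm_sq_to_K] at this
  exact_mod_cast this

/-- Bessel's inequality for the initial projections. -/
theorem sum_norm_sq_le (h : OrthoPartialIsometries V) (s : Finset ι) (x : E) :
    ∑ i ∈ s, ‖V i x‖ ^ 2 ≤ ‖x‖ ^ 2 := by
  set a := ∑ i ∈ s, ‖V i x‖ ^ 2 with ha
  -- `y` is the projection of `x` to the sum of the initial spaces
  set y := ∑ i ∈ s, ((V i)†) (V i x) with hy
  have hxy : RCLike.re ⟪x, y⟫_ℂ = a := by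
    rw [hy, inner_sum, map_sum]
    refine Finset.sum_congr rfl fun i _ => ?_
    rw [ContinuousLinearMap.adjoint_inner_right, inner_self_eq_norm_sq]
  have hyy : ‖y‖ ^ 2 = a := by
    rw [hy, ha]
    have h' : OrthogonalFamily ℂ
        (fun i => LinearMap.range ((V i)† : F →ₗ[ℂ] E))
        fun i => (LinearMap.range ((V i)† : F →ₗ[ℂ] E)).subtypeₗᵢ :=
      h.adjoint.orthogonalFamily
    have := h'.norm_sum (fun i => ⟨((V i)†) (V i x), V i x, rfl⟩) s
    refine this.trans (Finset.sum_congr rfl fun i _ => ?_)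
    exact h.norm_adjoint_apply_apply i x
  have h0 : 0 ≤ ‖x - y‖ ^ 2 := by positivity
  rw [@norm_sub_sq ℂ, hxy, hyy] at h0
  linarith

theorem summable_apply (h : OrthoPartialIsometries V) (x : E) : Summable fun i => V i x := by
  refine (h.orthogonalFamily.summable_iff_norm_sq_summable (fun i => ⟨V i x, x, rfl⟩)).2 ?_
  exact summable_of_sum_le (fun _ => by positivity) fun s => h.sum_norm_sq_le s x

/-- The sum of a family of partial isometries with orthogonal initial and final spaces, converging
in the strong operator topology. -/
noncomputable def sum (h : OrthoPartialIsometries V) : E →L[ℂ] F :=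
  LinearMap.mkContinuous
    { toFun := fun x => ∑' i, V i x
      map_add' := fun x y => by
        simp only [map_add]
        exact (h.summable_apply x).tsum_add (h.summable_apply y)
      map_smul' := fun c x => by
        simp only [map_smul]
        exact (h.summable_apply x).tsum_const_smul c }
    1 fun x => by
      rw [one_mul]
      refine le_of_tendsto (h.summable_apply x).hasSum.norm (Filter.Eventually.of_forall fun s => ?_)
      have := (h.norm_sum_sq s x).le.trans (h.sum_norm_sq_le s x)
      exact (sq_le_sq₀ (norm_nonneg _) (norm_nonneg _)).1 this

theorem hasSum_apply (h : OrthoPartialIsometries V) (x : E) : HasSum (fun i => V i x) (h.sum x) :=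
  (h.summable_apply x).hasSum

theorem sum_comp_adjoint (h : OrthoPartialIsometries V) (j : ι) :
    h.sum ∘L (V j)† = V j ∘L (V j)† := by
  ext x
  refine (h.hasSum_apply _).unique (hasSum_single j fun i hij => ?_)
  exact DFunLike.congr_fun (h.comp_adjoint i j hij) x

theorem adjoint_comp_sum (h : OrthoPartialIsometries V) (j : ι) :
    (V j)† ∘L h.sum = (V j)† ∘L V j := by
  ext x
  refine ((h.hasSum_apply x).mapL ((V j)†)).unique
    (hasSum_single j fun i hij => ?_)
  exact DFunLike.congr_fun (h.adjoint_comp j i hij.symm) x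

theorem adjoint_sum (h : OrthoPartialIsometries V) :
    h.sum† = h.adjoint.sum := by
  symm
  rw [ContinuousLinearMap.eq_adjoint_iff]
  intro x y
  have h1 := (h.adjoint.hasSum_apply x).mapL (innerSL ℂ y)
  have h2 := ((h.hasSum_apply y).mapL (innerSL ℂ x)).star
  rw [← inner_conj_symm, ← inner_conj_symm x]
  congr 1
  refine h1.unique ?_
  simpa [ContinuousLinearMap.adjoint_inner_right] using h2

theorem sum_adjoint_comp (h : OrthoPartialIsometries V) (j : ι) :
    h.sum† ∘L V j = (V j)† ∘L V j := by
  simpa [ContinuousLinearMap.adjoint_comp] using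
    congrArg ContinuousLinearMap.adjoint (h.adjoint_comp_sum j)

theorem sum_comp_sum_adjoint_comp (h : OrthoPartialIsometries V) (j : ι) :
    h.sum ∘L h.sum† ∘L V j = V j := by
  rw [h.sum_adjoint_comp, ← ContinuousLinearMap.comp_assoc, h.sum_comp_adjoint,
    ContinuousLinearMap.comp_assoc, h.partialIsometry]

/-- An identity `T V i = T' V i S` valid for all summands passes to the strong sum. -/
theorem comp_sum_congr (h : OrthoPartialIsometries V) {G : Type*} [NormedAddCommGroup G]
    [InnerProductSpace ℂ G] {S : E →L[ℂ] E} {T T' : F →L[ℂ] G}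
    (hT : ∀ i, T ∘L V i = T' ∘L V i ∘L S) : T ∘L h.sum = T' ∘L h.sum ∘L S := by
  ext x
  refine ((h.hasSum_apply x).mapL T).unique ?_
  have := (h.hasSum_apply (S x)).mapL T'
  have hfun : (fun i => T (V i x)) = fun i => T' (V i (S x)) :=
    funext fun i => DFunLike.congr_fun (hT i) x
  rw [hfun]
  exact this

theorem sum_partialIsometry (h : OrthoPartialIsometries V) :
    h.sum ∘L h.sum† ∘L h.sum = h.sum := by
  have := h.comp_sum_congr (T := h.sum ∘L h.sum†)
    (T' := .id ℂ F) (S := .id ℂ E) fun i => by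
      simpa [ContinuousLinearMap.comp_assoc] using h.sum_comp_sum_adjoint_comp i
  simpa [ContinuousLinearMap.comp_assoc] using this

section Pairs

variable {G : Type*} [NormedAddCommGroup G] [InnerProductSpace ℂ G] [CompleteSpace G]
  {B : ι → G →L[ℂ] F} {C : ι → G →L[ℂ] E}

/-- Two families of partial isometries with mutually orthogonal final spaces and the same initial
projections combine to a family carrying the final spaces of `C` to those of `B`. -/
theorem of_pair (hB : ∀ i j, i ≠ j → (B i)† ∘L B j = 0) (hC : ∀ i j, i ≠ j → (C i)† ∘L C j = 0)
    (hBC : ∀ i, (B i)† ∘L B i = (C i)† ∘L C i) (hCC : ∀ i, C i ∘L (C i)† ∘L C i = C i) :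
    OrthoPartialIsometries fun i => B i ∘L (C i)† where
  partialIsometry i := by
    have hC' : (C i)† ∘L C i ∘L (C i)† = (C i)† := by
      simpa [ContinuousLinearMap.adjoint_comp, ContinuousLinearMap.comp_assoc] using
        congrArg ContinuousLinearMap.adjoint (hCC i)
    simp only [ContinuousLinearMap.adjoint_comp, ContinuousLinearMap.adjoint_adjoint]
    calc _ = B i ∘L ((C i)† ∘L C i) ∘L ((B i)† ∘L B i) ∘L (C i)† := by
          simp only [ContinuousLinearMap.comp_assoc]
      _ = _ := by
          rw [hBC]
          simp only [ContinuousLinearMap.comp_assoc, hC']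
  comp_adjoint i j hij := by
    simp only [ContinuousLinearMap.adjoint_comp, ContinuousLinearMap.adjoint_adjoint]
    calc _ = B i ∘L ((C i)† ∘L C j) ∘L (B j)† := by simp only [ContinuousLinearMap.comp_assoc]
      _ = 0 := by rw [hC i j hij]; simp
  adjoint_comp i j hij := by
    simp only [ContinuousLinearMap.adjoint_comp, ContinuousLinearMap.adjoint_adjoint]
    calc _ = C i ∘L ((B i)† ∘L B j) ∘L (C j)† := by simp only [ContinuousLinearMap.comp_assoc]
      _ = 0 := by rw [hB i j hij]; simp

theorem sum_pair_comp (h : OrthoPartialIsometries fun i => B i ∘L (C i)†)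
    (hC : ∀ i j, i ≠ j → (C i)† ∘L C j = 0) (hBC : ∀ i, B i ∘L (C i)† ∘L C i = B i) (j : ι) :
    h.sum ∘L C j = B j := by
  ext x
  refine (h.hasSum_apply _).unique ?_
  have h1 : B j x = (B j ∘L (C j)†) (C j x) := (DFunLike.congr_fun (hBC j) x).symm
  rw [h1]
  refine hasSum_single j fun i hij => ?_
  have h2 := DFunLike.congr_fun (hC i j hij) x
  simp only [ContinuousLinearMap.comp_apply] at h2
  simp [h2]

theorem sum_pair_adjoint_comp (h : OrthoPartialIsometries fun i => B i ∘L (C i)†)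
    (hB : ∀ i j, i ≠ j → (B i)† ∘L B j = 0) (hBC : ∀ i, C i ∘L (B i)† ∘L B i = C i) (j : ι) :
    h.sum† ∘L B j = C j := by
  rw [h.adjoint_sum]
  ext x
  refine (h.adjoint.hasSum_apply _).unique ?_
  have h1 : C j x = (C j ∘L (B j)†) (B j x) := (DFunLike.congr_fun (hBC j) x).symm
  simp only [ContinuousLinearMap.adjoint_comp, ContinuousLinearMap.adjoint_adjoint]
  rw [h1]
  refine hasSum_single j fun i hij => ?_
  have h2 := DFunLike.congr_fun (hB i j hij) x
  simp only [ContinuousLinearMap.comp_apply] at h2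
  simp [h2]

end Pairs

end OrthoPartialIsometries

end StrongSums

section StrongSumsInAlgebra

variable {ι : Type*} {H : Type*} [NormedAddCommGroup H] [InnerProductSpace ℂ H] [CompleteSpace H]

theorem mem_of_commute_commutant {A : VonNeumannAlgebra H} {T : H →L[ℂ] H}
    (h : ∀ S ∈ A.commutant, S * T = T * S) : T ∈ A := by
  rw [← A.commutant_commutant, VonNeumannAlgebra.mem_commutant_iff]
  exact h

theorem commute_of_mem_commutant {A : VonNeumannAlgebra H} {S T : H →L[ℂ] H}
    (hS : S ∈ A.commutant) (hT : T ∈ A) : S * T = T * S :=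
  (VonNeumannAlgebra.mem_commutant_iff.1 hS T hT).symm

theorem OrthoPartialIsometries.sum_mem {V : ι → H →L[ℂ] H} (h : OrthoPartialIsometries V)
    {A : VonNeumannAlgebra H} (hV : ∀ i, V i ∈ A) : h.sum ∈ A :=
  mem_of_commute_commutant fun S hS =>
    h.comp_sum_congr (T := S) (T' := .id ℂ H) (S := S) fun i => commute_of_mem_commutant hS (hV i)

end StrongSumsInAlgebra

/-- Zorn's lemma for sets of mutually related elements. -/
theorem exists_maximal_pairwise {α : Type*} {r : α → α → Prop} {S s₀ : Set α}
    (hs₀ : s₀ ⊆ S) (h₀ : s₀.Pairwise r) :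
    ∃ m, s₀ ⊆ m ∧ m ⊆ S ∧ m.Pairwise r ∧
      ∀ a ∈ S, (∀ b ∈ m, r a b ∧ r b a) → a ∈ m := by
  obtain ⟨m, hm, hmax⟩ := zorn_subset_nonempty {s | s ⊆ S ∧ s.Pairwise r} (fun c hc hchain _ =>
    ⟨⋃₀ c, ⟨Set.sUnion_subset fun s hs => (hc hs).1,
      (Set.pairwise_sUnion hchain.directedOn).2 fun s hs => (hc hs).2⟩,
      fun s hs => Set.subset_sUnion_of_mem hs⟩) s₀ ⟨hs₀, h₀⟩
  refine ⟨m, hm, hmax.prop.1, hmax.prop.2, fun a ha hr => ?_⟩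
  refine hmax.le_of_ge (y := insert a m) ⟨Set.insert_subset ha hmax.prop.1, ?_⟩
    (Set.subset_insert a m) (Set.mem_insert a m)
  exact hmax.prop.2.insert fun b hb _ => hr b hb

/-! ### Polar decomposition and comparison of projections in a factor -/

section Factor

variable {H : Type*} [NormedAddCommGroup H] [InnerProductSpace ℂ H] [CompleteSpace H]
  {A : VonNeumannAlgebra H}

theorem isStarProjection_star_mul_self {V : H →L[ℂ] H} (h : V * (star V * V) = V) :
    IsStarProjection (star V * V) where
  isIdempotentElem := by
    change star V * V * (star V * V) = star V * V
    rw [mul_assoc, h]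
  isSelfAdjoint := .star_mul_self V

theorem isStarProjection_mul_star_self {V : H →L[ℂ] H} (h : V * (star V * V) = V) :
    IsStarProjection (V * star V) where
  isIdempotentElem := by
    change V * star V * (V * star V) = V * star V
    rw [← mul_assoc, mul_assoc V, h]
  isSelfAdjoint := .mul_star_self V

theorem mul_star_mul_self_of_star_mul_self {V P : H →L[ℂ] H} (hP : IsStarProjection P)
    (h : star V * V = P) : V * P = V := by
  have h0 : star (V - V * P) * (V - V * P) = 0 := by
    simp only [star_sub, star_mul, hP.isSelfAdjoint.star_eq, sub_mul, mul_sub]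
    simp only [mul_assoc, ← mul_assoc (star V) V, h]
    simp only [hP.isIdempotentElem.eq, sub_self]
  rw [CStarRing.star_mul_self_eq_zero_iff] at h0
  exact (sub_eq_zero.1 h0).symm

theorem starProjection_mem {K : Submodule ℂ H} [K.HasOrthogonalProjection]
    (h : ∀ S ∈ A.commutant, ∀ x ∈ K, S x ∈ K) : K.starProjection ∈ A := by
  rw [VonNeumannAlgebra.IsStarProjection.mem_iff isStarProjection_starProjection]
  intro S hS x hx
  simp only [Submodule.range_starProjection] at hx ⊢
  exact h S hS x hx

theorem map_mem_topologicalClosure_span {E : Type*} [NormedAddCommGroup E]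
    [InnerProductSpace ℂ E] {S : E →L[ℂ] E} {s : Set E} (h : ∀ x ∈ s, S x ∈ s) :
    ∀ x ∈ (Submodule.span ℂ s).topologicalClosure,
      S x ∈ (Submodule.span ℂ s).topologicalClosure := by
  have h1 : Submodule.span ℂ s ≤ (Submodule.span ℂ s).comap (S : E →ₗ[ℂ] E) :=
    Submodule.span_le.2 fun x hx => Submodule.subset_span (h x hx)
  have h2 : Set.MapsTo S (Submodule.span ℂ s) (Submodule.span ℂ s) := fun x hx => h1 hx
  exact h2.closure S.continuous

/-- In a factor, nonzero elements are connected: the closed span of `A P H` reduces both `A` and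
its commutant, so its projection is a scalar. -/
theorem IsFactor.exists_mul_mul_ne_zero (hA : IsFactor A) {P Q : H →L[ℂ] H} (hPA : P ∈ A)
    (hP : P ≠ 0) (hQ : Q ≠ 0) : ∃ T ∈ A, Q * T * P ≠ 0 := by
  by_contra! hzero
  set s : Set H := {y | ∃ T ∈ A, ∃ x, y = T (P x)} with hs
  set K := (Submodule.span ℂ s).topologicalClosure with hK
  have : CompleteSpace K := (Submodule.isClosed_topologicalClosure _).completeSpace_coe
  have hsK : ∀ y ∈ s, y ∈ K := fun y hy =>
    Submodule.le_topologicalClosure _ (Submodule.subset_span hy)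
  have h1 : K.starProjection ∈ A := starProjection_mem fun S hS =>
    map_mem_topologicalClosure_span fun y ⟨T, hT, x, hy⟩ => ⟨T, hT, S x, by
      have e1 := DFunLike.congr_fun (commute_of_mem_commutant hS hT) (P x)
      have e2 := DFunLike.congr_fun (commute_of_mem_commutant hS hPA) x
      simp only [mul_apply_eq_comp] at e1 e2
      rw [hy, e1, e2]⟩
  have h2 : K.starProjection ∈ A.commutant := starProjection_mem fun S hS =>
    map_mem_topologicalClosure_span fun y ⟨T, hT, x, hy⟩ => by
      rw [A.commutant_commutant] at hS
      exact ⟨S * T, mul_mem hS hT, x, by rw [hy]; rfl⟩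
  obtain ⟨c, hc⟩ := hA _ h1 h2
  obtain ⟨x, hx⟩ := DFunLike.ne_iff.1 hP
  have hxK : P x ∈ K := hsK _ ⟨1, one_mem A, x, rfl⟩
  have hc1 : c = 1 := by
    have := Submodule.starProjection_eq_self_iff.2 hxK
    rw [hc] at this
    have h0 : (c - 1) • P x = 0 := by
      rw [sub_smul, one_smul, sub_eq_zero]
      exact this
    exact sub_eq_zero.1 ((smul_eq_zero.1 h0).resolve_right hx)
  apply hQ
  ext y
  have hy : y ∈ K := by
    rw [← Submodule.starProjection_eq_self_iff, hc, hc1]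
    simp
  have hker : Submodule.span ℂ s ≤ LinearMap.ker (Q : H →ₗ[ℂ] H) :=
    Submodule.span_le.2 fun y ⟨T, hT, x, hy⟩ => by
      rw [hy]
      exact DFunLike.congr_fun (hzero T hT) x
  exact Submodule.topologicalClosure_minimal _ hker (ContinuousLinearMap.isClosed_ker Q) hy

theorem norm_cfcAbs_apply (T : H →L[ℂ] H) (x : H) : ‖CFC.abs T x‖ = ‖T x‖ := by
  have hsa : star (CFC.abs T) = CFC.abs T := (CFC.abs_nonneg T).isSelfAdjoint.star_eq
  have h : star (CFC.abs T) * CFC.abs T = star T * T := by rw [hsa, CFC.abs_mul_abs]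
  have h1 : ⟪CFC.abs T x, CFC.abs T x⟫_ℂ = ⟪T x, T x⟫_ℂ := by
    rw [← ContinuousLinearMap.adjoint_inner_right, ← ContinuousLinearMap.adjoint_inner_right]
    exact congrArg (fun y => ⟪x, y⟫_ℂ) (DFunLike.congr_fun h x)
  rw [inner_self_eq_norm_sq_to_K, inner_self_eq_norm_sq_to_K] at h1
  have h2 : ‖CFC.abs T x‖ ^ 2 = ‖T x‖ ^ 2 := by exact_mod_cast h1
  exact (sq_eq_sq₀ (norm_nonneg _) (norm_nonneg _)).1 h2

/-- Polar decomposition inside a von Neumann algebra: `T = V |T|` with a partial isometry `V ∈ A`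
whose initial and final spaces are contained in those of `T`. -/
theorem exists_polar {T : H →L[ℂ] H} (hT : T ∈ A) :
    ∃ V ∈ A, V * (star V * V) = V ∧ V * CFC.abs T = T ∧ (∀ Q, Q * T = T → Q * V = V) ∧
      ∀ P, IsStarProjection P → T * P = T → V * P = V := by
  set a := CFC.abs T with ha
  have hsa : star a = a := (CFC.abs_nonneg T).isSelfAdjoint.star_eq
  set K := (LinearMap.range (a : H →ₗ[ℂ] H)).topologicalClosure with hK
  have : CompleteSpace K := (Submodule.isClosed_topologicalClosure _).completeSpace_coe
  have haK : ∀ x, a x ∈ K := fun x => Submodule.le_topologicalClosure _ ⟨x, rfl⟩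
  set e : H →ₗ[ℂ] K := (a : H →ₗ[ℂ] H).codRestrict K haK with he
  have hdense : DenseRange e := by
    intro z
    rw [closure_subtype]
    have hz := z.2
    have himg : ((↑) : K → H) '' Set.range e = Set.range a := by
      rw [← Set.range_comp]; rfl
    rw [himg]
    exact hz
  have hnorm : ∀ x, ‖(T : H →ₗ[ℂ] H) x‖ = ‖e x‖ := fun x => (norm_cfcAbs_apply T x).symm
  set W : K →L[ℂ] H := (T : H →ₗ[ℂ] H).extendOfNorm e with hW
  have hWe : ∀ x, W (e x) = T x := fun x =>
    LinearMap.extendOfNorm_eq hdense ⟨1, fun x => by rw [one_mul, hnorm]⟩ x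
  have hWnorm : ∀ z, ‖W z‖ = ‖z‖ := by
    intro z
    refine hdense.induction_on (p := fun z => ‖W z‖ = ‖z‖) z
      (isClosed_eq (by fun_prop) (by fun_prop)) fun x => ?_
    rw [hWe]
    exact hnorm x
  have hWW : W† ∘L W = 1 := (W.norm_map_iff_adjoint_comp_self).1 hWnorm
  set V : H →L[ℂ] H := W ∘L K.orthogonalProjectionOnto with hV
  have hVa : ∀ x, V (a x) = T x := by
    intro x
    rw [← hWe, hV]
    simp only [ContinuousLinearMap.comp_apply]
    congr 1
    exact Submodule.orthogonalProjectionOnto_mem_subspace_eq_self (e x)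
  have hVo : ∀ y ∈ Kᗮ, V y = 0 := by
    intro y hy
    simp [hV, Submodule.orthogonalProjectionOnto_apply_of_mem_orthogonal hy]
  have hmem : ∀ y, (∀ x, ⟪a x, y⟫_ℂ = 0) → y ∈ Kᗮ := by
    intro y hy
    rw [hK, Submodule.orthogonal_closure, Submodule.mem_orthogonal]
    rintro _ ⟨x, rfl⟩
    exact hy x
  have hmem' : ∀ y ∈ Kᗮ, ∀ x, ⟪a x, y⟫_ℂ = 0 := fun y hy x =>
    (Submodule.mem_orthogonal _ _).1 hy _ (haK x)
  have hext : ∀ R S : H →L[ℂ] H, (∀ x, R (a x) = S (a x)) → (∀ y ∈ Kᗮ, R y = S y) → R = S := by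
    intro R S h1 h2
    have hker : K ≤ LinearMap.ker ((R - S : H →L[ℂ] H) : H →ₗ[ℂ] H) := by
      refine Submodule.topologicalClosure_minimal _ ?_ (ContinuousLinearMap.isClosed_ker (R - S))
      rintro _ ⟨x, rfl⟩
      exact sub_eq_zero.2 (h1 x)
    ext y
    have e1 : R (K.starProjection y) = S (K.starProjection y) :=
      sub_eq_zero.1 (hker (K.starProjection_apply_mem y))
    have e2 := h2 _ (K.sub_starProjection_mem_orthogonal y)
    rw [map_sub, map_sub, e1] at e2
    exact sub_left_injective e2
  refine ⟨V, mem_of_commute_commutant fun S hS => ?_, ?_, ?_, fun Q hQ => ?_, fun P hP hTP => ?_⟩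
  · have hST := commute_of_mem_commutant hS hT
    have hSs : star S ∈ A.commutant := star_mem hS
    have hSsT := commute_of_mem_commutant hSs hT
    have haS : Commute S a := Commute.cfcAbs_right (Commute.symm hST) (Commute.symm hSsT)
    have haS' : Commute (star S) a :=
      Commute.cfcAbs_right (Commute.symm hSsT) (by rw [star_star]; exact Commute.symm hST)
    refine hext _ _ (fun x => ?_) fun y hy => ?_
    · have e1 := DFunLike.congr_fun haS.eq x
      have e2 := DFunLike.congr_fun hST x
      simp only [mul_apply_eq_comp] at e1 e2 ⊢
      rw [e1, hVa, hVa, e2]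
    · simp only [mul_apply_eq_comp]
      rw [hVo y hy, hVo (S y) (hmem _ fun x => ?_), map_zero]
      rw [← ContinuousLinearMap.adjoint_inner_left]
      have e1 := DFunLike.congr_fun haS'.eq x
      simp only [mul_apply_eq_comp, ContinuousLinearMap.star_eq_adjoint] at e1
      rw [e1]
      exact hmem' y hy _
  · have h1 : star V * V = K.starProjection := by
      change V† ∘L V = _
      rw [hV, ContinuousLinearMap.adjoint_comp, ContinuousLinearMap.comp_assoc,
        ← ContinuousLinearMap.comp_assoc _ W, hWW, Submodule.adjoint_orthogonalProjectionOnto]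
      rfl
    rw [h1]
    refine hext _ _ (fun x => ?_) fun y hy => ?_
    · simp only [mul_apply_eq_comp]
      rw [Submodule.starProjection_eq_self_iff.2 (haK x)]
    · simp only [mul_apply_eq_comp]
      rw [hVo y hy, (Submodule.starProjection_apply_eq_zero_iff _).2 hy, map_zero]
  · ext x
    exact hVa x
  · refine hext _ _ (fun x => ?_) fun y hy => ?_
    · simp only [mul_apply_eq_comp, hVa]
      exact DFunLike.congr_fun hQ x
    · simp only [mul_apply_eq_comp]
      rw [hVo y hy, map_zero]
  · have haP : a * P = a := by
      ext x
      have : ‖a (x - P x)‖ = 0 := by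
        rw [ha, norm_cfcAbs_apply, map_sub, norm_eq_zero, sub_eq_zero]
        exact (DFunLike.congr_fun hTP x).symm
      rw [norm_eq_zero, map_sub, sub_eq_zero] at this
      exact this.symm
    have hPa : P * a = a := by
      have := congrArg star haP
      rwa [star_mul, hsa, hP.isSelfAdjoint.star_eq] at this
    refine hext _ _ (fun x => ?_) fun y hy => ?_
    · have e1 := DFunLike.congr_fun hPa x
      simp only [mul_apply_eq_comp] at e1 ⊢
      rw [e1]
    · simp only [mul_apply_eq_comp]
      rw [hVo y hy, hVo (P y) (hmem _ fun x => ?_)]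
      have hPs : P† = P := hP.isSelfAdjoint.star_eq
      rw [← ContinuousLinearMap.adjoint_inner_left, hPs]
      have e1 := DFunLike.congr_fun hPa x
      simp only [mul_apply_eq_comp] at e1
      rw [e1]
      exact hmem' y hy x

/-- Comparison of projections in a factor. -/
theorem IsFactor.comparison (hA : IsFactor A) {P Q : H →L[ℂ] H} (hP : IsProj A P)
    (hQ : IsProj A Q) :
    ∃ V ∈ A, V * P = V ∧ Q * V = V ∧ V * (star V * V) = V ∧
      (star V * V = P ∨ V * star V = Q) := by
  -- a maximal set of partial isometries from `P` to `Q` with orthogonal initial and final spaces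
  obtain ⟨m, -, hmS, hmr, hmax⟩ := exists_maximal_pairwise (α := H →L[ℂ] H)
    (r := fun V W => V * star W = 0 ∧ star V * W = 0)
    (S := {V | V ∈ A ∧ V ≠ 0 ∧ V * P = V ∧ Q * V = V ∧ V * (star V * V) = V}) (s₀ := ∅)
    (Set.empty_subset _) (Set.pairwise_empty _)
  have hfam : OrthoPartialIsometries (fun V : m => (V : H →L[ℂ] H)) :=
    ⟨fun V => (hmS V.2).2.2.2.2,
      fun V W hVW => (hmr V.2 W.2 fun h => hVW (Subtype.ext h)).1,
      fun V W hVW => (hmr V.2 W.2 fun h => hVW (Subtype.ext h)).2⟩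
  have hSA : hfam.sum ∈ A := hfam.sum_mem fun V => (hmS V.2).1
  set S := hfam.sum with hS
  have hSP : S * P = S :=
    (hfam.comp_sum_congr (T := .id ℂ H) (T' := .id ℂ H) (S := P)
      fun V => ((hmS V.2).2.2.1).symm).symm
  have hQS : Q * S = S :=
    hfam.comp_sum_congr (T := Q) (T' := .id ℂ H) (S := .id ℂ H) fun V => (hmS V.2).2.2.2.1
  have hSS : S * (star S * S) = S := hfam.sum_partialIsometry
  refine ⟨S, hSA, hSP, hQS, hSS, ?_⟩
  by_contra! hne
  obtain ⟨T, hTA, hT⟩ := hA.exists_mul_mul_ne_zero (P := P - star S * S) (Q := Q - S * star S)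
    (sub_mem hP.1 (mul_mem (star_mem hSA) hSA)) (sub_ne_zero.2 hne.1.symm)
    (sub_ne_zero.2 hne.2.symm)
  have hPs := hP.2.isSelfAdjoint.star_eq
  have hQs := hQ.2.isSelfAdjoint.star_eq
  have hPS : P * star S = star S := by
    have := congrArg star hSP
    rwa [star_mul, hPs] at this
  have hSQ : star S * Q = star S := by
    have := congrArg star hQS
    rwa [star_mul, hQs] at this
  have hTmem : (Q - S * star S) * T * (P - star S * S) ∈ A :=
    mul_mem (mul_mem (sub_mem hQ.1 (mul_mem hSA (star_mem hSA))) hTA)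
      (sub_mem hP.1 (mul_mem (star_mem hSA) hSA))
  obtain ⟨V, hVA, hVV, hVT, hVQ, hVP⟩ := exists_polar hTmem
  have hp1 := isStarProjection_star_mul_self hSS
  have hp2 := isStarProjection_mul_star_self hSS
  have hp2' := hp2.isIdempotentElem.eq
  have hP1 : (P - star S * S) * P = P - star S * S := by
    rw [sub_mul, hP.2.isIdempotentElem.eq, mul_assoc, hSP]
  have hQ1 : Q * (Q - S * star S) = Q - S * star S := by
    rw [mul_sub, hQ.2.isIdempotentElem.eq, ← mul_assoc, hQS]
  have hP2 : (P - star S * S) * star S = 0 := by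
    have := congrArg star hSS
    simp only [star_mul, star_star] at this
    rw [sub_mul, hPS, this, sub_self]
  have hQ2 : S * star S * (Q - S * star S) = 0 := by
    rw [mul_sub, hp2', mul_assoc, hSQ, sub_self]
  have hV1 : V * P = V := hVP P hP.2 (by rw [mul_assoc, hP1])
  have hV2 : Q * V = V := hVQ Q (by simp only [← mul_assoc, hQ1])
  have hV3 : V * (1 - star S * S) = V := hVP _ hp1.one_sub (by
    rw [mul_sub, mul_one, mul_assoc _ _ (star S * S), ← mul_assoc _ (star S), hP2,
      zero_mul, mul_zero, sub_zero])
  have hV4 : (1 - S * star S) * V = V := hVQ _ (by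
    rw [sub_mul, one_mul, ← mul_assoc, ← mul_assoc, hQ2, zero_mul, zero_mul, sub_zero])
  have hV5 : V * (star S * S) = 0 := by
    rwa [mul_sub, mul_one, sub_eq_self] at hV3
  have hV6 : (S * star S) * V = 0 := by
    rwa [sub_mul, one_mul, sub_eq_self] at hV4
  have hV0 : V ≠ 0 := by
    rintro rfl
    exact hT (by rw [← hVT, zero_mul])
  have hVm : V ∈ m := by
    refine hmax V ⟨hVA, hV0, hV1, hV2, hVV⟩ fun W hW => ?_
    have e1 : S * star S * W = W := hfam.sum_comp_sum_adjoint_comp ⟨W, hW⟩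
    have e2 : star S * S * star W = star W := by
      have h1 : S * star W = W * star W := hfam.sum_comp_adjoint ⟨W, hW⟩
      have h2 : star S * W = star W * W := hfam.sum_adjoint_comp ⟨W, hW⟩
      have h3 := congrArg star (hmS hW).2.2.2.2
      simp only [star_mul, star_star] at h3
      rw [mul_assoc, h1, ← mul_assoc, h2, h3]
    have e3 : V * star W = 0 := by rw [← e2, ← mul_assoc, hV5, zero_mul]
    have e4 : star W * V = 0 := by
      have : star W * (S * star S) = star W := by
        have := congrArg star e1
        simpa [star_mul, mul_assoc] using this
      rw [← this, mul_assoc, hV6, mul_zero]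
    exact ⟨⟨e3, by simpa using congrArg star e4⟩, by simpa using congrArg star e3, e4⟩
  have : S * star S * V = V := hfam.sum_comp_sum_adjoint_comp ⟨V, hVm⟩
  exact hV0 (by rw [← this, hV6])

end Factor

/-! ### Finite and infinite projections -/

section FiniteProjections

variable {H : Type*} [NormedAddCommGroup H] [InnerProductSpace ℂ H] [CompleteSpace H]
  {A : VonNeumannAlgebra H}

theorem mul_mul_of_mul_eq {R : Type*} [Semigroup R] {a b c : R} (h : a * b = c) (x : R) :
    a * (b * x) = c * x := by
  rw [← mul_assoc, h]

theorem IsProj.lt_of_mul_eq {P Q : H →L[ℂ] H} (hP : IsProj A P) (hQ : IsProj A Q)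
    (h : P * Q = Q) (hne : Q ≠ P) : Q < P :=
  lt_of_le_of_ne ((hQ.2.le_iff_mul_eq_right hP.2).2 h) hne

theorem isInfiniteProj_of_isometry {P X : H →L[ℂ] H} (hP : IsProj A P) (hX : X ∈ A)
    (hXX : star X * X = P) (hPX : P * X = X) (hne : X * star X ≠ P) : IsInfiniteProj A P := by
  have hXP : X * (star X * X) = X := by
    rw [hXX, mul_star_mul_self_of_star_mul_self hP.2 hXX]
  have hQ : IsProj A (X * star X) :=
    ⟨mul_mem hX (star_mem hX), isStarProjection_mul_star_self hXP⟩
  exact ⟨hP, X * star X, hQ, hP.lt_of_mul_eq hQ (by rw [← mul_assoc, hPX]) hne,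
    star X, star_mem hX, by rw [star_star], by rw [star_star, hXX]⟩

theorem IsInfiniteProj.exists_isometry {P : H →L[ℂ] H} (h : IsInfiniteProj A P) :
    ∃ X ∈ A, star X * X = P ∧ P * X = X ∧ X * star X ≠ P := by
  obtain ⟨hP, Q, hQ, hlt, V, hV, h1, h2⟩ := h
  have hPQ : P * Q = Q := (hQ.2.le_iff_mul_eq_right hP.2).1 hlt.le
  have hVQ := mul_star_mul_self_of_star_mul_self hQ.2 h1
  have hQV : Q * star V = star V := by
    have := congrArg star hVQ
    rwa [star_mul, hQ.2.isSelfAdjoint.star_eq] at this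
  refine ⟨star V, star_mem hV, by rw [star_star, h2], ?_, by rw [star_star, h1]; exact hlt.ne⟩
  rw [← hQV, ← mul_assoc, hPQ]

/-- A projection that dominates, up to equivalence, an infinite projection is infinite: extend the
shift by the identity on the complement. -/
theorem IsInfiniteProj.of_subequivalent {G P V : H →L[ℂ] H} (hG : IsInfiniteProj A G)
    (hP : IsProj A P) (hV : V ∈ A) (hVV : star V * V = G) (hPV : P * V = V) :
    IsInfiniteProj A P := by
  obtain ⟨W, hW, h1, h2, h3⟩ := hG.exists_isometry
  have hGs := hG.1.2.isSelfAdjoint.star_eq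
  have hPs := hP.2.isSelfAdjoint.star_eq
  have hGG := hG.1.2.isIdempotentElem.eq
  have hPP := hP.2.isIdempotentElem.eq
  have hVG := mul_star_mul_self_of_star_mul_self hG.1.2 hVV
  have hGV : G * star V = star V := by simpa [hGs] using congrArg star hVG
  have hVP : star V * P = star V := by simpa [hPs] using congrArg star hPV
  have hWG := mul_star_mul_self_of_star_mul_self hG.1.2 h1
  have hGW : star W * G = star W := by simpa [hGs] using congrArg star h2
  have hX : V * W * star V + (P - V * star V) ∈ A :=
    add_mem (mul_mem (mul_mem hV hW) (star_mem hV)) (sub_mem hP.1 (mul_mem hV (star_mem hV)))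
  have hsX : star (V * W * star V + (P - V * star V)) =
      V * star W * star V + (P - V * star V) := by
    simp [hPs, mul_assoc]
  refine isInfiniteProj_of_isometry hP hX ?_ ?_ ?_
  · rw [hsX]
    simp only [add_mul, mul_add, mul_sub, sub_mul, mul_assoc, mul_mul_of_mul_eq hVV,
      mul_mul_of_mul_eq h2, mul_mul_of_mul_eq h1, mul_mul_of_mul_eq hPV, hGV, hVP, hPP]
    abel
  · simp only [mul_add, mul_sub, mul_assoc, mul_mul_of_mul_eq hPV, hPP]
  · rw [hsX]
    intro h
    apply h3
    have h4 : V * (W * (star W * star V)) = V * star V := by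
      simp only [add_mul, mul_add, mul_sub, sub_mul, mul_assoc, mul_mul_of_mul_eq hVV,
        mul_mul_of_mul_eq hVG, mul_mul_of_mul_eq hWG, mul_mul_of_mul_eq hPV, hGV, hVP, hPP] at h
      have h5 : V * (W * (star W * star V)) - V * star V = 0 := by
        have := sub_eq_zero.2 h
        rw [← this]
        abel
      exact sub_eq_zero.1 h5
    have h6 := congrArg (fun T => star V * T * V) h4
    simpa only [mul_assoc, mul_mul_of_mul_eq hVV, hVV, mul_mul_of_mul_eq h2, hGW, hGG] using h6

theorem IsFiniteProj.not_isInfiniteProj {P : H →L[ℂ] H} (h : IsFiniteProj A P) :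
    ¬ IsInfiniteProj A P := fun ⟨_, Q, hQ, hlt, heq⟩ => h.2 Q hQ hlt heq

theorem isFiniteProj_of_not_isInfiniteProj {P : H →L[ℂ] H} (hP : IsProj A P)
    (h : ¬ IsInfiniteProj A P) : IsFiniteProj A P :=
  ⟨hP, fun Q hQ hlt heq => h ⟨hP, Q, hQ, hlt, heq⟩⟩

theorem IsFiniteProj.of_mul_eq {P Q : H →L[ℂ] H} (h : IsFiniteProj A P) (hQ : IsProj A Q)
    (hPQ : P * Q = Q) : IsFiniteProj A Q :=
  isFiniteProj_of_not_isInfiniteProj hQ fun hinf => h.not_isInfiniteProj <|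
    hinf.of_subequivalent h.1 hQ.1
      (by rw [hQ.2.isSelfAdjoint.star_eq, hQ.2.isIdempotentElem.eq]) hPQ

/-- Infinitely many orthogonal copies of a nonzero projection add up to an infinite projection, by
means of the unilateral shift. -/
theorem exists_isInfiniteProj_of_sequence {F : H →L[ℂ] H} (hF : IsStarProjection F) (hF0 : F ≠ 0)
    {x : ℕ → H →L[ℂ] H} (hx : ∀ j, x j ∈ A) (hxx : ∀ j, star (x j) * x j = F)
    (hxy : ∀ i j, i ≠ j → star (x i) * x j = 0) :
    ∃ G, IsInfiniteProj A G ∧ ∀ T, (∀ j, T * x j = 0) → T * G = 0 := by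
  have hxF := fun j => mul_star_mul_self_of_star_mul_self hF (hxx j)
  have hxx' : ∀ j k, x j * (star (x k) * x k) = x j := fun j k => by rw [hxx k, hxF]
  have hB : ∀ i j, i ≠ j → star (x (i + 1)) * x (j + 1) = 0 := fun i j hij =>
    hxy _ _ (by simpa using hij)
  have h := OrthoPartialIsometries.of_pair (B := fun j => x (j + 1)) (C := x) hB hxy
    (fun j => (hxx (j + 1)).trans (hxx j).symm) (fun j => hxx' j j)
  have hS1 : ∀ j, h.sum * x j = x (j + 1) := fun j =>
    h.sum_pair_comp hxy (fun j => hxx' (j + 1) j) j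
  have hS2 : ∀ j, star h.sum * x (j + 1) = x j := fun j =>
    h.sum_pair_adjoint_comp hB (fun j => hxx' j (j + 1)) j
  have hSA : h.sum ∈ A := h.sum_mem fun j => mul_mem (hx (j + 1)) (star_mem (hx j))
  have hpi : h.sum * (star h.sum * h.sum) = h.sum := h.sum_partialIsometry
  have hG : IsProj A (star h.sum * h.sum) :=
    ⟨mul_mem (star_mem hSA) hSA, isStarProjection_star_mul_self hpi⟩
  have hGx : ∀ j, star h.sum * h.sum * x j = x j := fun j => by rw [mul_assoc, hS1, hS2]
  have hGS : star h.sum * h.sum * h.sum = h.sum :=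
    h.comp_sum_congr (T := star h.sum * h.sum) (T' := .id ℂ H) (S := .id ℂ H) fun j =>
      mul_mul_of_mul_eq (hGx (j + 1)) (star (x j))
  refine ⟨star h.sum * h.sum, isInfiniteProj_of_isometry hG hSA rfl hGS fun heq => hF0 ?_,
    fun T hT => ?_⟩
  · have h0 : star (x 0) * h.sum = 0 :=
      (h.comp_sum_congr (T := star (x 0)) (T' := (0 : H →L[ℂ] H)) (S := .id ℂ H) fun j => by
        have : star (x 0) * (x (j + 1) * star (x j)) = 0 := by
          rw [← mul_assoc, hxy 0 (j + 1) (by simp), zero_mul]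
        simpa using! this).trans (by simp)
    have h1 : star h.sum * x 0 = 0 := by simpa using congrArg star h0
    have h2 : x 0 = 0 := by rw [← hGx 0, ← heq, mul_assoc, h1, mul_zero]
    rw [← hxx 0, h2, mul_zero]
  · have h0 : T * star h.sum = 0 := by
      change T ∘L h.sum† = 0
      rw [h.adjoint_sum]
      refine (h.adjoint.comp_sum_congr (T := T) (T' := (0 : H →L[ℂ] H)) (S := .id ℂ H)
        fun j => ?_).trans (by simp)
      have : T * (x j * star (x (j + 1))) = 0 := by rw [← mul_assoc, hT, zero_mul]
      simpa [ContinuousLinearMap.adjoint_comp] using! this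
    rw [← mul_assoc, h0, zero_mul]

/-- A factor with an infinite projection contains infinitely many orthogonal copies of each of its
finite projections. -/
theorem IsFactor.exists_sequence_copies (hA : IsFactor A) (hinf : ∃ Q, IsInfiniteProj A Q)
    {P : H →L[ℂ] H} (hP : IsFiniteProj A P) :
    ∃ U : ℕ → H →L[ℂ] H, (∀ n, U n ∈ A) ∧ (∀ n, star (U n) * U n = P) ∧
      ∀ m n, m ≠ n → star (U m) * U n = 0 := by
  obtain ⟨Q, hQ⟩ := hinf
  have h1 : IsInfiniteProj A 1 := hQ.of_subequivalent ⟨one_mem A, .one _⟩ hQ.1.1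
    (by rw [hQ.1.2.isSelfAdjoint.star_eq, hQ.1.2.isIdempotentElem.eq]) (one_mul Q)
  obtain ⟨W, hW, hWW, -, hne⟩ := h1.exists_isometry
  have hF : IsStarProjection (1 - W * star W) :=
    (isStarProjection_mul_star_self (by rw [hWW, mul_one])).one_sub
  set F := 1 - W * star W with hFdef
  have hF0 : F ≠ 0 := sub_ne_zero.2 hne.symm
  have hFW : F * W = 0 := by rw [hFdef, sub_mul, one_mul, mul_assoc, hWW, mul_one, sub_self]
  have hFA : F ∈ A := sub_mem (one_mem A) (mul_mem hW (star_mem hW))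
  have hpow : ∀ n, star (W ^ n) * W ^ n = 1 := by
    intro n
    induction n with
    | zero => simp
    | succ n ih => rw [pow_succ', star_mul, mul_assoc, mul_mul_of_mul_eq hWW, one_mul, ih]
  have hFs := hF.isSelfAdjoint.star_eq
  -- the partial isometries `W ^ n * F` have initial projection `F` and orthogonal final projections
  have hX : ∀ n, star (W ^ n * F) * (W ^ n * F) = F := fun n => by
    rw [star_mul, hFs, mul_assoc, mul_mul_of_mul_eq (hpow n), one_mul, hF.isIdempotentElem.eq]
  have hXlt : ∀ m n, m < n → star (W ^ m * F) * (W ^ n * F) = 0 := fun m n hmn => by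
    obtain ⟨k, rfl⟩ := Nat.exists_eq_add_of_lt hmn
    rw [star_mul, hFs, mul_assoc, add_assoc, pow_add, mul_assoc (W ^ m),
      mul_mul_of_mul_eq (hpow m), one_mul, pow_succ', mul_assoc, mul_mul_of_mul_eq hFW, zero_mul]
  have hXne : ∀ m n, m ≠ n → star (W ^ m * F) * (W ^ n * F) = 0 := fun m n hmn => by
    rcases lt_or_gt_of_ne hmn with h | h
    · exact hXlt m n h
    · simpa using congrArg star (hXlt n m h)
  -- arrange the copies of `F` in a double sequence, and add up each row
  have hrow := fun k => exists_isInfiniteProj_of_sequence (A := A) hF hF0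
    (x := fun j => W ^ Nat.pair k j * F) (fun j => mul_mem (pow_mem hW _) hFA)
    (fun j => hX _) (fun i j hij => hXne _ _ fun h => hij (Nat.pair_eq_pair.1 h).2)
  choose G hG hGT using hrow
  have hGG : ∀ k l, k ≠ l → G k * G l = 0 := fun k l hkl => by
    refine hGT l _ fun j => ?_
    have h0 : star (W ^ Nat.pair l j * F) * G k = 0 := hGT k _ fun i =>
      hXne _ _ fun h => hkl (Nat.pair_eq_pair.1 h).1.symm
    have := congrArg star h0
    rwa [star_mul, star_star, (hG k).1.2.isSelfAdjoint.star_eq, star_zero] at this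
  have hU : ∀ k, ∃ V ∈ A, star V * V = P ∧ G k * V = V := fun k => by
    obtain ⟨V, hV, hVP, hGV, -, h | h⟩ := hA.comparison hP.1 (hG k).1
    · exact ⟨V, hV, h, hGV⟩
    · refine absurd ((hG k).of_subequivalent hP.1 (star_mem hV) (by rwa [star_star]) ?_)
        hP.not_isInfiniteProj
      have := congrArg star hVP
      rwa [star_mul, hP.1.2.isSelfAdjoint.star_eq] at this
  choose U hUA hUU hGU using hU
  refine ⟨U, hUA, hUU, fun m n hmn => ?_⟩
  have h3 : star (U m) * G m = star (U m) := by
    have := congrArg star (hGU m)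
    rwa [star_mul, (hG m).1.2.isSelfAdjoint.star_eq] at this
  rw [← h3, ← hGU n, mul_assoc, mul_mul_of_mul_eq (hGG m n hmn), zero_mul, mul_zero]

end FiniteProjections

/-! ### The identity as a sum of copies of a finite projection -/

section Decomposition

variable {H : Type*} [NormedAddCommGroup H] [InnerProductSpace ℂ H] [CompleteSpace H]
  {A : VonNeumannAlgebra H}

/-- A maximal infinite family of orthogonal copies of `P`; the complement of their sum is
equivalent to a subprojection of `P`, via `Y`. -/
theorem IsFactor.exists_maximal_copies (hA : IsFactor A) (hinf : ∃ Q, IsInfiniteProj A Q)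
    {P : H →L[ℂ] H} (hP : IsFiniteProj A P) (hP0 : P ≠ 0) :
    ∃ m : Set (H →L[ℂ] H), m.Infinite ∧ (∀ V ∈ m, V ∈ A ∧ star V * V = P) ∧
      (∀ V ∈ m, ∀ W ∈ m, V ≠ W → star V * W = 0) ∧
      ∃ Y ∈ A, P * Y = Y ∧ Y * (star Y * Y) = Y ∧ (∀ V ∈ m, Y * V = 0) ∧
        ∀ x, Y x = 0 → (∀ V ∈ m, star V x = 0) → x = 0 := by
  obtain ⟨U, hUA, hUU, hUne⟩ := hA.exists_sequence_copies hinf hP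
  have hUinj : Function.Injective U := by
    intro k l hkl
    by_contra hne
    exact hP0 (by rw [← hUU k, ← hUne k l hne, hkl])
  obtain ⟨m, hUm, hmS, hmr, hmax⟩ := exists_maximal_pairwise (α := H →L[ℂ] H)
    (r := fun V W => star V * W = 0) (S := {V | V ∈ A ∧ star V * V = P}) (s₀ := Set.range U)
    (by rintro _ ⟨k, rfl⟩; exact ⟨hUA k, hUU k⟩)
    (by
      rintro _ ⟨k, rfl⟩ _ ⟨l, rfl⟩ h
      exact hUne k l fun hkl => h (congrArg U hkl))
  have hmP : ∀ V ∈ m, V * P = V := fun V hV =>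
    mul_star_mul_self_of_star_mul_self hP.1.2 (hmS hV).2
  have hC : ∀ V W : m, V ≠ W → star (V : H →L[ℂ] H) * (W : H →L[ℂ] H) = 0 := fun V W h =>
    hmr V.2 W.2 fun h' => h (Subtype.ext h')
  have hCC : ∀ V : m, (V : H →L[ℂ] H) * (star (V : H →L[ℂ] H) * (V : H →L[ℂ] H)) = V :=
    fun V => by rw [(hmS V.2).2, hmP V V.2]
  have h := OrthoPartialIsometries.of_pair (B := fun V : m => (V : H →L[ℂ] H))
    (C := fun V : m => (V : H →L[ℂ] H)) hC hC (fun _ => rfl) hCC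
  have hE1 : ∀ V : m, h.sum * V = V := h.sum_pair_comp hC hCC
  have hE2 : ∀ V : m, star h.sum * V = V := h.sum_pair_adjoint_comp hC hCC
  have hEA : h.sum ∈ A := h.sum_mem fun V => mul_mem (hmS V.2).1 (star_mem (hmS V.2).1)
  have hEp : IsStarProjection (star h.sum * h.sum) :=
    isStarProjection_star_mul_self h.sum_partialIsometry
  set R := 1 - star h.sum * h.sum with hR
  have hRp : IsProj A R :=
    ⟨sub_mem (one_mem A) (mul_mem (star_mem hEA) hEA), hEp.one_sub⟩
  have hRV : ∀ V ∈ m, R * V = 0 := fun V hV => by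
    rw [hR, sub_mul, one_mul, mul_assoc, hE1 ⟨V, hV⟩, hE2 ⟨V, hV⟩, sub_self]
  obtain ⟨Y, hYA, hYR, hPY, hYY, hor⟩ := hA.comparison hRp hP.1
  have hYV : ∀ V ∈ m, Y * V = 0 := fun V hV => by
    rw [← hYR, mul_assoc, hRV V hV, mul_zero]
  refine ⟨m, Set.infinite_of_injective_forall_mem hUinj fun k => hUm ⟨k, rfl⟩,
    fun V hV => hmS hV, fun V hV W hW => hmr hV hW, Y, hYA, hPY, hYY, hYV, ?_⟩
  rcases hor with hor | hor
  · intro x hYx hVx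
    have hRx : R x = 0 := by
      rw [← hor, mul_apply_eq_comp, hYx, map_zero]
    have hEx : h.sum x = 0 := by
      refine (h.hasSum_apply x).unique ?_
      have : (fun V : m => ((V : H →L[ℂ] H) ∘L (V : H →L[ℂ] H)†) x) = fun _ => 0 := by
        funext V
        rw [ContinuousLinearMap.comp_apply]
        exact (congrArg (V : H →L[ℂ] H) (hVx V V.2)).trans (map_zero _)
      rw [this]
      exact hasSum_zero
    have : R x = x - star h.sum (h.sum x) := rfl
    rw [hRx, hEx, map_zero, sub_zero] at this
    exact this.symm
  · -- if `P` were equivalent to a subprojection of the complement, the family could be enlarged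
    exfalso
    have hVY : ∀ V ∈ m, star V * star Y = 0 := fun V hV => by
      rw [← star_mul, hYV V hV, star_zero]
    have hYm : star Y ∈ m := hmax (star Y) ⟨star_mem hYA, by rwa [star_star]⟩ fun V hV =>
      ⟨by rw [star_star, hYV V hV], hVY V hV⟩
    have := hVY _ hYm
    rw [star_star, hor] at this
    exact hP0 this

/-- A factor with an infinite projection is an infinite multiple of each nonzero finite projection:
the identity is the sum of infinitely many orthogonal copies of `P`. -/
theorem IsFactor.exists_total_copies (hA : IsFactor A) (hinf : ∃ Q, IsInfiniteProj A Q)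
    {P : H →L[ℂ] H} (hP : IsFiniteProj A P) (hP0 : P ≠ 0) :
    ∃ m : Set (H →L[ℂ] H), m.Infinite ∧ ∃ X : m → H →L[ℂ] H, (∀ i, X i ∈ A) ∧
      (∀ i, star (X i) * X i = P) ∧ (∀ i j, i ≠ j → star (X i) * X j = 0) ∧
      ∀ x, (∀ i, star (X i) x = 0) → x = 0 := by
  obtain ⟨m, hm, hmA, hmne, Y, hYA, hPY, hYY, hYV, htot⟩ := hA.exists_maximal_copies hinf hP hP0
  have : Infinite m := hm.to_subtype
  obtain ⟨e⟩ : Nonempty (Option m ≃ m) := by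
    rw [← Cardinal.eq, Cardinal.mk_option, Cardinal.add_one_eq (Cardinal.aleph0_le_mk m)]
  have hPs := hP.1.2.isSelfAdjoint.star_eq
  have hPP := hP.1.2.isIdempotentElem.eq
  have hmP : ∀ V : m, (V : H →L[ℂ] H) * P = V := fun V =>
    mul_star_mul_self_of_star_mul_self hP.1.2 (hmA V V.2).2
  have hmV : ∀ V : m, star (V : H →L[ℂ] H) * (V : H →L[ℂ] H) = P := fun V => (hmA V V.2).2
  have hmVW : ∀ V W : m, V ≠ W → star (V : H →L[ℂ] H) * (W : H →L[ℂ] H) = 0 := fun V W h =>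
    hmne V V.2 W W.2 fun h' => h (Subtype.ext h')
  -- `K` is the copy of the complement inside `P`
  set K := Y * star Y with hK
  have hKp : IsStarProjection K := isStarProjection_mul_star_self hYY
  have hKs := hKp.isSelfAdjoint.star_eq
  have hKK := hKp.isIdempotentElem.eq
  have hPK : P * K = K := by rw [hK, ← mul_assoc, hPY]
  have hKP : K * P = K := by
    have := congrArg star hPK
    rwa [star_mul, hPs, hKs] at this
  have hKA : K ∈ A := mul_mem hYA (star_mem hYA)
  -- Hilbert's hotel: the complement and the `K`-parts of all copies are moved onto the `K`-parts of
  -- all copies, while the `P - K`-parts stay in place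
  let q : Option m ⊕ m → H →L[ℂ] H := Sum.elim (fun _ => K) (fun _ => P - K)
  let B : Option m ⊕ m → H →L[ℂ] H :=
    Sum.elim (fun o => (e o : H →L[ℂ] H) * K) (fun V => (V : H →L[ℂ] H) * (P - K))
  let C : Option m ⊕ m → H →L[ℂ] H :=
    Sum.elim (fun o => o.elim (star Y) fun V => (V : H →L[ℂ] H) * K)
      (fun V => (V : H →L[ℂ] H) * (P - K))
  have hqK : (P - K) * K = 0 := by rw [sub_mul, hPK, hKK, sub_self]
  have hKq : K * (P - K) = 0 := by rw [mul_sub, hKP, hKK, sub_self]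
  have hqs : star (P - K) = P - K := by rw [star_sub, hPs, hKs]
  have hqq : (P - K) * (P - K) = P - K := by rw [sub_mul, hKq, sub_zero, mul_sub, hPP, hPK]
  have hPq : P * (P - K) = P - K := by rw [mul_sub, hPP, hPK]
  have hVKVK : ∀ V W : m, ∀ a b : H →L[ℂ] H, V ≠ W →
      star ((V : H →L[ℂ] H) * a) * ((W : H →L[ℂ] H) * b) = 0 := fun V W a b h => by
    rw [star_mul, mul_assoc, mul_mul_of_mul_eq (hmVW V W h), zero_mul, mul_zero]
  have hVV : ∀ V : m, ∀ a b : H →L[ℂ] H, P * b = b →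
      star ((V : H →L[ℂ] H) * a) * ((V : H →L[ℂ] H) * b) = star a * b := fun V a b h => by
    rw [star_mul, mul_assoc, mul_mul_of_mul_eq (hmV V), h]
  have hVab : ∀ V W : m, ∀ a b : H →L[ℂ] H, P * b = b → star a * b = 0 →
      star ((V : H →L[ℂ] H) * a) * ((W : H →L[ℂ] H) * b) = 0 := fun V W a b hb h => by
    by_cases hVW : V = W
    · rw [hVW, hVV W a b hb, h]
    · exact hVKVK V W a b hVW
  have hYVa : ∀ V : m, ∀ a : H →L[ℂ] H, star (star Y) * ((V : H →L[ℂ] H) * a) = 0 := fun V a => by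
    rw [star_star, ← mul_assoc, hYV V V.2, zero_mul]
  have hVaY : ∀ V : m, ∀ a : H →L[ℂ] H, star ((V : H →L[ℂ] H) * a) * star Y = 0 := fun V a => by
    have := congrArg star (hYVa V a)
    simpa [star_mul] using this
  have hBq : ∀ i, star (B i) * B i = q i := by
    rintro (o | V)
    · exact (hVV (e o) K K hPK).trans (by rw [hKs, hKK]; rfl)
    · exact (hVV V _ _ hPq).trans (by rw [hqs, hqq]; rfl)
  have hCq : ∀ i, star (C i) * C i = q i := by
    rintro ((_ | V) | V)
    · change star (star Y) * star Y = K
      rw [star_star]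
    · exact (hVV V K K hPK).trans (by rw [hKs, hKK]; rfl)
    · exact (hVV V _ _ hPq).trans (by rw [hqs, hqq]; rfl)
  have hq : ∀ i, IsStarProjection (q i) := by
    rintro (o | V)
    · exact hKp
    · exact ⟨hqq, hqs⟩
  have hB : ∀ i j, i ≠ j → star (B i) * B j = 0 := by
    rintro (o | V) (o' | W) hij
    · exact hVKVK _ _ _ _ fun h => hij (congrArg Sum.inl (e.injective h))
    · exact hVab _ _ _ _ hPq (by rw [hKs, hKq])
    · exact hVab _ _ _ _ hPK (by rw [hqs, hqK])
    · exact hVKVK _ _ _ _ fun h => hij (congrArg Sum.inr h)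
  have hC : ∀ i j, i ≠ j → star (C i) * C j = 0 := by
    rintro ((_ | V) | V) ((_ | W) | W) hij
    · exact absurd rfl hij
    · exact hYVa _ _
    · exact hYVa _ _
    · exact hVaY _ _
    · exact hVKVK _ _ _ _ fun h => hij (by rw [h])
    · exact hVab _ _ _ _ hPq (by rw [hKs, hKq])
    · exact hVaY _ _
    · exact hVab _ _ _ _ hPK (by rw [hqs, hqK])
    · exact hVKVK _ _ _ _ fun h => hij (by rw [h])
  have hBC : ∀ i, B i * (star (C i) * C i) = B i := fun i => by
    rw [hCq, mul_star_mul_self_of_star_mul_self (hq i) (hBq i)]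
  have hCB : ∀ i, C i * (star (B i) * B i) = C i := fun i => by
    rw [hBq, mul_star_mul_self_of_star_mul_self (hq i) (hCq i)]
  have h := OrthoPartialIsometries.of_pair (B := B) (C := C) hB hC
    (fun i => (hBq i).trans (hCq i).symm)
    (fun i => (congrArg (C i * ·) ((hCq i).trans (hBq i).symm)).trans (hCB i))
  have hWC : ∀ i, h.sum * C i = B i := h.sum_pair_comp hC hBC
  have hWB : ∀ i, star h.sum * B i = C i := h.sum_pair_adjoint_comp hB hCB
  have hBA : ∀ i, B i ∈ A := by
    rintro (o | V)
    · exact mul_mem (hmA _ (e o).2).1 hKA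
    · exact mul_mem (hmA _ V.2).1 (sub_mem hP.1.1 hKA)
  have hCA : ∀ i, C i ∈ A := by
    rintro ((_ | V) | V)
    · exact star_mem hYA
    · exact mul_mem (hmA _ V.2).1 hKA
    · exact mul_mem (hmA _ V.2).1 (sub_mem hP.1.1 hKA)
  have hWA : h.sum ∈ A := h.sum_mem fun i => mul_mem (hBA i) (star_mem (hCA i))
  have hsplit : ∀ V : m, (V : H →L[ℂ] H) = B (Sum.inl (e.symm V)) + B (Sum.inr V) := fun V => by
    change (V : H →L[ℂ] H) = (e (e.symm V) : H →L[ℂ] H) * K + (V : H →L[ℂ] H) * (P - K)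
    rw [e.apply_symm_apply, ← mul_add, add_sub_cancel, hmP]
  have hWWV : ∀ V : m, h.sum * (star h.sum * V) = V := fun V => by
    rw [hsplit V, mul_add, hWB, hWB, mul_add, hWC, hWC]
  -- the isometry `h.sum` maps `H` onto the sum of the copies `V`, so pulling these back along it
  -- gives copies that exhaust `H`
  have hXX : ∀ V W : m, star (star h.sum * (V : H →L[ℂ] H)) * (star h.sum * (W : H →L[ℂ] H)) =
      star (V : H →L[ℂ] H) * W := fun V W => by
    rw [star_mul, star_star, mul_assoc, hWWV]
  refine ⟨m, hm, fun V => star h.sum * V, fun V => mul_mem (star_mem hWA) (hmA V V.2).1,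
    fun V => (hXX V V).trans (hmV V), fun V W hVW => (hXX V W).trans (hmVW V W hVW),
    fun x hx => ?_⟩
  have hVW : ∀ V : m, star (V : H →L[ℂ] H) (h.sum x) = 0 := fun V => by
    have := hx V
    rwa [star_mul, star_star] at this
  have hBx : ∀ i, star (B i) (h.sum x) = 0 := by
    rintro (o | V)
    · change star ((e o : H →L[ℂ] H) * K) (h.sum x) = 0
      rw [star_mul, mul_apply_eq_comp, hVW, map_zero]
    · change star ((V : H →L[ℂ] H) * (P - K)) (h.sum x) = 0
      rw [star_mul, mul_apply_eq_comp, hVW, map_zero]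
  have hCx : ∀ i, star (C i) x = 0 := fun i => by
    rw [← hWB i, star_mul, star_star, mul_apply_eq_comp, hBx]
  refine htot x ?_ fun V hV => ?_
  · have : star (star Y) x = 0 := hCx (Sum.inl none)
    rwa [star_star] at this
  · have hVC : V = C (Sum.inl (some ⟨V, hV⟩)) + C (Sum.inr ⟨V, hV⟩) := by
      change V = V * K + V * (P - K)
      rw [← mul_add, add_sub_cancel, hmP ⟨V, hV⟩]
    rw [hVC, star_add, add_apply, hCx, hCx, add_zero]

end Decomposition

/-! ### The corner algebra -/

section CornerAlgebra

variable {H : Type u} [NormedAddCommGroup H] [InnerProductSpace ℂ H]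

/-- The inclusion of `PH` into `H`. -/
noncomputable def incl (P : H →L[ℂ] H) : projSpace P →L[ℂ] H := (projSpace P).subtypeL

theorem comp_incl (P : H →L[ℂ] H) : P ∘L incl P = incl P := by
  ext x
  exact mem_projSpace.1 x.2

variable [CompleteSpace H] {A : VonNeumannAlgebra H} {P : H →L[ℂ] H}

theorem adjoint_incl_comp (hP : IsStarProjection P) : (incl P)† ∘L P = (incl P)† := by
  have := congrArg ContinuousLinearMap.adjoint (comp_incl P)
  have hPs : P† = P := hP.isSelfAdjoint.star_eq
  rwa [ContinuousLinearMap.adjoint_comp, hPs] at this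

theorem adjoint_incl_comp_incl (P : H →L[ℂ] H) : (incl P)† ∘L incl P = 1 :=
  ((incl P).norm_map_iff_adjoint_comp_self).1 fun _ => rfl

theorem incl_comp_adjoint_incl (hP : IsStarProjection P) : incl P ∘L (incl P)† = P := by
  have hmem : ∀ x, P x ∈ projSpace P := fun x =>
    mem_projSpace.2 (DFunLike.congr_fun hP.isIdempotentElem.eq x)
  have h : incl P ∘L (P.codRestrict (projSpace P) hmem) = P := by ext x; rfl
  have h2 : (incl P)† ∘L P = P.codRestrict (projSpace P) hmem := by
    have h3 := congrArg (fun T => (incl P)† ∘L T) h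
    simp only [← ContinuousLinearMap.comp_assoc, adjoint_incl_comp_incl] at h3
    exact h3.symm
  rw [← adjoint_incl_comp hP, h2, h]

/-- The compression of an operator on `H` to `PH`. -/
noncomputable def compress (P T : H →L[ℂ] H) : projSpace P →L[ℂ] projSpace P :=
  (incl P)† ∘L T ∘L incl P

/-- The extension by zero of an operator on `PH` to `H`. -/
noncomputable def lift (P : H →L[ℂ] H) (S : projSpace P →L[ℂ] projSpace P) : H →L[ℂ] H :=
  incl P ∘L S ∘L (incl P)†

theorem star_compress (T : H →L[ℂ] H) : star (compress P T) = compress P (star T) := by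
  simp only [ContinuousLinearMap.star_eq_adjoint, compress, ContinuousLinearMap.adjoint_comp,
    ContinuousLinearMap.adjoint_adjoint, ContinuousLinearMap.comp_assoc]

theorem star_lift (S : projSpace P →L[ℂ] projSpace P) : star (lift P S) = lift P (star S) := by
  simp only [ContinuousLinearMap.star_eq_adjoint, lift, ContinuousLinearMap.adjoint_comp,
    ContinuousLinearMap.adjoint_adjoint, ContinuousLinearMap.comp_assoc]

theorem compress_lift (S : projSpace P →L[ℂ] projSpace P) : compress P (lift P S) = S := by
  calc _ = ((incl P)† ∘L incl P) ∘L S ∘L ((incl P)† ∘L incl P) := by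
        simp only [compress, lift, ContinuousLinearMap.comp_assoc]
    _ = S := by rw [adjoint_incl_comp_incl]; rfl

theorem lift_injective : Function.Injective (lift P) :=
  Function.LeftInverse.injective compress_lift

theorem lift_compress (hP : IsStarProjection P) (T : H →L[ℂ] H) :
    lift P (compress P T) = P * T * P := by
  calc _ = (incl P ∘L (incl P)†) ∘L T ∘L (incl P ∘L (incl P)†) := by
        simp only [compress, lift, ContinuousLinearMap.comp_assoc]
    _ = _ := by rw [incl_comp_adjoint_incl hP]; rfl

theorem lift_mul (S T : projSpace P →L[ℂ] projSpace P) : lift P (S * T) = lift P S * lift P T := by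
  symm
  calc _ = incl P ∘L S ∘L ((incl P)† ∘L incl P) ∘L T ∘L (incl P)† := by
        simp only [lift, ContinuousLinearMap.comp_assoc]; rfl
    _ = _ := by rw [adjoint_incl_comp_incl]; rfl

theorem mul_lift (S : projSpace P →L[ℂ] projSpace P) : P * lift P S = lift P S := by
  change P ∘L incl P ∘L S ∘L (incl P)† = _
  rw [← ContinuousLinearMap.comp_assoc, comp_incl]
  rfl

theorem lift_zero : lift P 0 = 0 := by simp [lift]

theorem lift_one (hP : IsStarProjection P) : lift P 1 = P :=
  incl_comp_adjoint_incl hP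

/-- An operator commuting with `P` restricts to `PH`. -/
theorem comp_incl_of_commute (hP : IsStarProjection P) {T : H →L[ℂ] H} (h : T * P = P * T) :
    T ∘L incl P = incl P ∘L compress P T := by
  symm
  calc _ = (incl P ∘L (incl P)†) ∘L T ∘L incl P := by
        simp only [compress, ContinuousLinearMap.comp_assoc]
    _ = (P * T) ∘L incl P := by rw [incl_comp_adjoint_incl hP]; rfl
    _ = T ∘L (P ∘L incl P) := by rw [← h]; rfl
    _ = _ := by rw [comp_incl]

theorem adjoint_incl_comp_of_commute (hP : IsStarProjection P) {T : H →L[ℂ] H}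
    (h : T * P = P * T) : (incl P)† ∘L T = compress P T ∘L (incl P)† := by
  symm
  calc _ = (incl P)† ∘L T ∘L (incl P ∘L (incl P)†) := by
        simp only [compress, ContinuousLinearMap.comp_assoc]
    _ = (incl P)† ∘L (T * P) := by rw [incl_comp_adjoint_incl hP]; rfl
    _ = ((incl P)† ∘L P) ∘L T := by rw [h]; rfl
    _ = _ := by rw [adjoint_incl_comp hP]

variable (A P) in
/-- The algebra `P A P` on `PH`, defined as the commutant of the compression of the commutant
of `A`. -/
noncomputable def cornerAlgebra : VonNeumannAlgebra (projSpace P) :=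
  (generated (compress P '' (A.commutant : Set (H →L[ℂ] H)))).commutant

theorem mem_cornerAlgebra_iff_commute {S : projSpace P →L[ℂ] projSpace P} :
    S ∈ cornerAlgebra A P ↔ ∀ T ∈ A.commutant, compress P T * S = S * compress P T := by
  have hstar : star (compress P '' (A.commutant : Set (H →L[ℂ] H))) ⊆
      compress P '' (A.commutant : Set (H →L[ℂ] H)) := by
    rintro S ⟨T, hT, hTS⟩
    have hTs : star T ∈ A.commutant := star_mem hT
    exact ⟨star T, hTs, by rw [← star_compress, hTS, star_star]⟩
  rw [← SetLike.mem_coe, cornerAlgebra, VonNeumannAlgebra.coe_commutant, coe_generated,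
    Set.centralizer_centralizer_centralizer, Set.union_eq_self_of_subset_right hstar,
    Set.mem_centralizer_iff]
  simp only [Set.forall_mem_image, SetLike.mem_coe]

theorem compress_mem (hP : IsProj A P) {T : H →L[ℂ] H} (hT : T ∈ A) :
    compress P T ∈ cornerAlgebra A P := by
  rw [mem_cornerAlgebra_iff_commute]
  intro S hS
  have h1 := commute_of_mem_commutant hS hP.1
  calc _ = (compress P S ∘L (incl P)†) ∘L T ∘L incl P := by
        simp only [compress, ContinuousLinearMap.comp_assoc]; rfl
    _ = (incl P)† ∘L (S * T) ∘L incl P := by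
        rw [← adjoint_incl_comp_of_commute hP.2 h1]; rfl
    _ = (incl P)† ∘L T ∘L S ∘L incl P := by rw [commute_of_mem_commutant hS hT]; rfl
    _ = _ := by rw [comp_incl_of_commute hP.2 h1]; rfl

theorem lift_mem (hP : IsProj A P) {S : projSpace P →L[ℂ] projSpace P}
    (hS : S ∈ cornerAlgebra A P) : lift P S ∈ A := by
  refine mem_of_commute_commutant fun T hT => ?_
  have h1 := commute_of_mem_commutant hT hP.1
  have h2 := mem_cornerAlgebra_iff_commute.1 hS T hT
  calc _ = (T ∘L incl P) ∘L S ∘L (incl P)† := rfl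
    _ = incl P ∘L (compress P T * S) ∘L (incl P)† := by rw [comp_incl_of_commute hP.2 h1]; rfl
    _ = incl P ∘L S ∘L (compress P T ∘L (incl P)†) := by rw [h2]; rfl
    _ = _ := by rw [← adjoint_incl_comp_of_commute hP.2 h1]; rfl

theorem coe_cornerAlgebra (hP : IsProj A P) :
    (cornerAlgebra A P : Set (projSpace P →L[ℂ] projSpace P)) = corner A P := by
  have key : ∀ (S : projSpace P →L[ℂ] projSpace P) (T : H →L[ℂ] H),
      (∀ x : projSpace P, (S x : H) = P (T (P x))) ↔ S = compress P T := by
    intro S T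
    have h : ∀ x : projSpace P, (compress P T x : H) = P (T (P x)) := fun x => by
      have h1 : incl P ∘L compress P T = P ∘L T ∘L incl P := by
        rw [compress, ← ContinuousLinearMap.comp_assoc, incl_comp_adjoint_incl hP.2]
      have h2 := DFunLike.congr_fun h1 x
      rw [mem_projSpace.1 x.2]
      exact h2
    constructor
    · intro hS
      ext x
      rw [hS, h]
    · rintro rfl
      exact h
  ext S
  simp only [corner, Set.mem_ofPred_eq, key, SetLike.mem_coe]
  constructor
  · intro hS
    exact ⟨lift P S, lift_mem hP hS, (compress_lift S).symm⟩
  · rintro ⟨T, hT, rfl⟩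
    exact compress_mem hP hT

theorem isProj_lift (hP : IsProj A P) {q : projSpace P →L[ℂ] projSpace P}
    (hq : IsProj (cornerAlgebra A P) q) : IsProj A (lift P q) := by
  refine ⟨lift_mem hP hq.1, ?_, ?_⟩
  · change lift P q * lift P q = _
    rw [← lift_mul, hq.2.isIdempotentElem.eq]
  · change star (lift P q) = _
    rw [star_lift, hq.2.isSelfAdjoint.star_eq]

theorem lift_lt_lift (hP : IsProj A P) {q r : projSpace P →L[ℂ] projSpace P}
    (hq : IsProj (cornerAlgebra A P) q) (hr : IsProj (cornerAlgebra A P) r) :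
    lift P q < lift P r ↔ q < r := by
  rw [lt_iff_le_and_ne, lt_iff_le_and_ne, hq.2.le_iff_mul_eq_right hr.2,
    (isProj_lift hP hq).2.le_iff_mul_eq_right (isProj_lift hP hr).2, ← lift_mul,
    lift_injective.eq_iff, lift_injective.ne_iff]

/-- A projection of `A` below `P` is the extension by zero of a projection of the corner. -/
theorem exists_isProj_lift_eq (hP : IsProj A P) {Q : H →L[ℂ] H} (hQ : IsProj A Q)
    (h : P * Q = Q) : ∃ q, IsProj (cornerAlgebra A P) q ∧ lift P q = Q := by
  have hQP : Q * P = Q := by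
    have := congrArg star h
    rwa [star_mul, hP.2.isSelfAdjoint.star_eq, hQ.2.isSelfAdjoint.star_eq] at this
  have hl : lift P (compress P Q) = Q := by rw [lift_compress hP.2, h, hQP]
  refine ⟨compress P Q, ⟨compress_mem hP hQ.1, ?_, ?_⟩, hl⟩
  · apply lift_injective
    rw [lift_mul, hl, hQ.2.isIdempotentElem.eq]
  · change star _ = _
    rw [star_compress, hQ.2.isSelfAdjoint.star_eq]

theorem isFiniteProj_cornerAlgebra (hP : IsFiniteProj A P)
    {q : projSpace P →L[ℂ] projSpace P} (hq : IsProj (cornerAlgebra A P) q) :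
    IsFiniteProj (cornerAlgebra A P) q := by
  refine ⟨hq, fun r hr hlt ⟨V, hV, h1, h2⟩ => ?_⟩
  refine (hP.of_mul_eq (isProj_lift hP.1 hq) (mul_lift q)).2 _ (isProj_lift hP.1 hr)
    ((lift_lt_lift hP.1 hr hq).2 hlt) ⟨lift P V, lift_mem hP.1 hV, ?_, ?_⟩
  · rw [star_lift, ← lift_mul, h1]
  · rw [star_lift, ← lift_mul, h2]

theorem not_exists_isMinimalProj_cornerAlgebra (hA : ¬ ∃ Q, IsMinimalProj A Q)
    (hP : IsProj A P) : ¬ ∃ q, IsMinimalProj (cornerAlgebra A P) q := by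
  rintro ⟨q, hq, hq0, hmin⟩
  refine hA ⟨lift P q, isProj_lift hP hq, fun h => hq0 (lift_injective (h.trans lift_zero.symm)),
    fun Q hQ hlt => ?_⟩
  have hqQ : lift P q * Q = Q :=
    (hQ.2.le_iff_mul_eq_right (isProj_lift hP hq).2).1 hlt.le
  obtain ⟨r, hr, rfl⟩ := exists_isProj_lift_eq hP hQ (by rw [← hqQ, ← mul_assoc, mul_lift])
  rw [hmin r hr ((lift_lt_lift hP hr hq).1 hlt), lift_zero]

/-- The corner of a finite projection is of type II₁ as soon as it is a factor. -/
theorem isFactorIIOne_cornerAlgebra (hA : IsFactorII A) (hP : IsFiniteProj A P) (hP0 : P ≠ 0)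
    (hfac : IsFactor (cornerAlgebra A P)) : IsFactorIIOne (cornerAlgebra A P) := by
  refine ⟨⟨hfac, ⟨1, isFiniteProj_cornerAlgebra hP ⟨one_mem _, .one _⟩, fun h => hP0 ?_⟩,
    not_exists_isMinimalProj_cornerAlgebra hA.2.2 hP.1⟩,
    fun q hq => isFiniteProj_cornerAlgebra hP hq⟩
  rw [← lift_one hP.1.2, h, lift_zero]

end CornerAlgebra

/-! ### Operators on the Hilbert space tensor product and the spatial isomorphism -/

section TotalFamilies

variable {ι : Type*} {D E G : Type*} [NormedAddCommGroup E] [InnerProductSpace ℂ E]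
  [CompleteSpace E] [NormedAddCommGroup G] [InnerProductSpace ℂ G] [CompleteSpace G]
  [NormedAddCommGroup D] [InnerProductSpace ℂ D]

/-- A family `L i` is total when its ranges span a dense subspace, stated as the vanishing of every
vector orthogonal to all of them. -/
theorem ext_of_total_left {L : ι → G →L[ℂ] E} (hL : ∀ x, (∀ i, ((L i)†) x = 0) → x = 0)
    {T T' : D →L[ℂ] E} (h : ∀ i, (L i)† ∘L T = (L i)† ∘L T') : T = T' := by
  ext x
  refine sub_eq_zero.1 (hL _ fun i => ?_)
  rw [map_sub, sub_eq_zero]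
  exact DFunLike.congr_fun (h i) x

theorem ext_of_total [CompleteSpace D] {L : ι → G →L[ℂ] E}
    (hL : ∀ x, (∀ i, ((L i)†) x = 0) → x = 0)
    {T T' : E →L[ℂ] D} (h : ∀ i, T ∘L L i = T' ∘L L i) : T = T' := by
  apply ContinuousLinearMap.adjoint.injective
  refine ext_of_total_left hL fun i => ?_
  rw [← ContinuousLinearMap.adjoint_comp, ← ContinuousLinearMap.adjoint_comp, h]

/-- Two operators commute if the first commutes with the matrix entries of the second with respect
to a total family of isometries, and with the projections of that family. -/
theorem commute_of_commute_entries {J : ι → G →L[ℂ] E}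
    (hJ : ∀ x, (∀ i, ((J i)†) x = 0) → x = 0) (hJJ : ∀ i, (J i)† ∘L J i = 1) {S Y : E →L[ℂ] E}
    (hS : ∀ i, (J i ∘L (J i)†) ∘L S = S ∘L J i ∘L (J i)†)
    (hY : ∀ i j, (J i ∘L ((J i)† ∘L Y ∘L J j) ∘L (J j)†) ∘L S =
      S ∘L J i ∘L ((J i)† ∘L Y ∘L J j) ∘L (J j)†) : S ∘L Y = Y ∘L S := by
  have hl : ∀ i, (J i)† ∘L S = (J i)† ∘L S ∘L J i ∘L (J i)† := fun i => by
    calc _ = ((J i)† ∘L J i) ∘L (J i)† ∘L S := by rw [hJJ]; rfl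
      _ = (J i)† ∘L (J i ∘L (J i)†) ∘L S := rfl
      _ = _ := by rw [hS]
  have hr : ∀ i, S ∘L J i = J i ∘L (J i)† ∘L S ∘L J i := fun i => by
    calc _ = S ∘L J i ∘L ((J i)† ∘L J i) := by rw [hJJ]; rfl
      _ = (S ∘L J i ∘L (J i)†) ∘L J i := rfl
      _ = _ := by rw [← hS]; rfl
  refine ext_of_total_left hJ fun i => ext_of_total hJ fun j => ?_
  calc _ = ((J i)† ∘L S) ∘L Y ∘L J j := rfl
    _ = (J i)† ∘L S ∘L J i ∘L ((J i)† ∘L Y ∘L J j) := by rw [hl]; rfl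
    _ = (J i)† ∘L S ∘L J i ∘L ((J i)† ∘L Y ∘L J j) ∘L ((J j)† ∘L J j) := by rw [hJJ j]; rfl
    _ = (J i)† ∘L (S ∘L J i ∘L ((J i)† ∘L Y ∘L J j) ∘L (J j)†) ∘L J j := rfl
    _ = ((J i)† ∘L J i) ∘L (J i)† ∘L Y ∘L J j ∘L (J j)† ∘L S ∘L J j := by rw [← hY]; rfl
    _ = (J i)† ∘L Y ∘L (J j ∘L (J j)† ∘L S ∘L J j) := by rw [hJJ]; rfl
    _ = _ := by rw [← hr j]; rfl

end TotalFamilies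

section Conjugation

variable {E F : Type*} [NormedAddCommGroup E] [InnerProductSpace ℂ E] [CompleteSpace E]
  [NormedAddCommGroup F] [InnerProductSpace ℂ F] [CompleteSpace F] {U : E →L[ℂ] F}

theorem conj_conj_adjoint (hU : U ∘L U† = 1) (T : F →L[ℂ] F) :
    U ∘L (U† ∘L T ∘L U) ∘L U† = T := by
  calc _ = (U ∘L U†) ∘L T ∘L (U ∘L U†) := rfl
    _ = T := by rw [hU]; rfl

theorem eq_smul_one_of_conj (hU : U ∘L U† = 1) {Z : F →L[ℂ] F} {c : ℂ}
    (h : U† ∘L Z ∘L U = c • 1) : Z = c • 1 := by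
  rw [← conj_conj_adjoint hU Z, h, ContinuousLinearMap.smul_comp, ContinuousLinearMap.comp_smul]
  exact congrArg (c • ·) hU

theorem commute_conj (hU : U† ∘L U = 1) {T : E →L[ℂ] E} {Z : F →L[ℂ] F}
    (h : Z * (U ∘L T ∘L U†) = (U ∘L T ∘L U†) * Z) :
    T * (U† ∘L Z ∘L U) = (U† ∘L Z ∘L U) * T := by
  calc _ = (U† ∘L U) ∘L T ∘L U† ∘L Z ∘L U := by rw [hU]; rfl
    _ = U† ∘L ((U ∘L T ∘L U†) * Z) ∘L U := rfl
    _ = U† ∘L Z ∘L U ∘L T ∘L (U† ∘L U) := by rw [← h]; rfl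
    _ = _ := by rw [hU]; rfl

end Conjugation

section HilbertTensorOperators

variable {K : Type u} [NormedAddCommGroup K] [InnerProductSpace ℂ K]
  {G : Type v} [NormedAddCommGroup G] [InnerProductSpace ℂ G]

variable (G) in
/-- The operator `y ↦ x ⊗ y` into the Hilbert space tensor product. -/
noncomputable def tmulL (x : K) : G →L[ℂ] HilbertTensor K G :=
  (UniformSpace.Completion.toComplL : (K ⊗[ℂ] G) →L[ℂ] HilbertTensor K G) ∘L
    TensorProduct.mkL ℂ K G x

theorem tmulL_apply (x : K) (y : G) :
    tmulL G x y = ((x ⊗ₜ[ℂ] y : K ⊗[ℂ] G) : HilbertTensor K G) := rfl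

theorem opTensor_comp_tmulL (a : K →L[ℂ] K) (b : G →L[ℂ] G) (x : K) :
    opTensor a b ∘L tmulL G x = tmulL G (a x) ∘L b := by
  ext y
  exact opTensor_tmul a b x y

theorem inner_tmulL_tmulL (x x' : K) (y y' : G) :
    ⟪tmulL G x y, tmulL G x' y'⟫_ℂ = ⟪x, x'⟫_ℂ * ⟪y, y'⟫_ℂ := by
  rw [tmulL_apply, tmulL_apply, UniformSpace.Completion.inner_coe, TensorProduct.inner_tmul]

/-- The elementary tensors span a dense subspace. -/
theorem eq_zero_of_inner_tmulL {z : HilbertTensor K G} (h : ∀ x y, ⟪tmulL G x y, z⟫_ℂ = 0) :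
    z = 0 := by
  have h1 : ∀ w : HilbertTensor K G, ⟪w, z⟫_ℂ = 0 := by
    intro w
    refine UniformSpace.Completion.induction_on (p := fun w : HilbertTensor K G => ⟪w, z⟫_ℂ = 0) w
      (isClosed_eq (by fun_prop) continuous_const) fun t => ?_
    induction t with
    | zero => rw [UniformSpace.Completion.coe_zero, inner_zero_left]
    | tmul x y => exact h x y
    | add s t hs ht => rw [UniformSpace.Completion.coe_add, inner_add_left, hs, ht, add_zero]
  exact inner_self_eq_zero.1 (h1 z)

variable [CompleteSpace G]

theorem adjoint_tmulL_comp_tmulL (x x' : K) : (tmulL G x)† ∘L tmulL G x' = ⟪x, x'⟫_ℂ • 1 := by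
  ext y
  refine ext_inner_left ℂ fun w => ?_
  rw [ContinuousLinearMap.comp_apply, ContinuousLinearMap.adjoint_inner_right, inner_tmulL_tmulL]
  simp [inner_smul_right]

theorem eq_zero_of_adjoint_tmulL {z : HilbertTensor K G} (h : ∀ x, ((tmulL G x)†) z = 0) :
    z = 0 :=
  eq_zero_of_inner_tmulL fun x y => by
    rw [← ContinuousLinearMap.adjoint_inner_right, h, inner_zero_right]

/-- The operators `y ↦ e i ⊗ y` form a total family if the `e i` do. -/
theorem total_tmulL {ι : Type*} {e : ι → K} (he : Dense (Submodule.span ℂ (Set.range e) : Set K))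
    {z : HilbertTensor K G} (h : ∀ i, ((tmulL G (e i))†) z = 0) : z = 0 := by
  refine eq_zero_of_inner_tmulL fun x y => ?_
  have hcont : Continuous fun x : K => ⟪tmulL G x y, z⟫_ℂ := by
    have : Continuous fun x : K => tmulL G x y :=
      (UniformSpace.Completion.continuous_coe (K ⊗[ℂ] G)).comp
        (TensorProduct.continuous_tmul.comp (Continuous.prodMk_left y))
    exact this.inner continuous_const
  refine he.induction (P := fun x => ⟪tmulL G x y, z⟫_ℂ = 0) (fun x hx => ?_)
    (isClosed_eq hcont continuous_const) x
  induction hx using Submodule.span_induction with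
  | mem x hx =>
    obtain ⟨i, rfl⟩ := hx
    rw [← ContinuousLinearMap.adjoint_inner_right, h, inner_zero_right]
  | zero =>
    rw [tmulL_apply, TensorProduct.zero_tmul, UniformSpace.Completion.coe_zero, inner_zero_left]
  | add x x' _ _ hx hx' =>
    rw [tmulL_apply, TensorProduct.add_tmul, UniformSpace.Completion.coe_add, inner_add_left]
    rw [tmulL_apply] at hx hx'
    rw [hx, hx', add_zero]
  | smul c x _ hx =>
    rw [tmulL_apply, ← TensorProduct.smul_tmul', UniformSpace.Completion.coe_smul, inner_smul_left]
    rw [tmulL_apply] at hx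
    rw [hx, mul_zero]

theorem opTensor_ext {T T' : HilbertTensor K G →L[ℂ] HilbertTensor K G}
    (h : ∀ x, T ∘L tmulL G x = T' ∘L tmulL G x) : T = T' :=
  ext_of_total (L := tmulL G) (fun _ hz => eq_zero_of_adjoint_tmulL hz) h

theorem opTensor_mul_opTensor (a a' : K →L[ℂ] K) (b b' : G →L[ℂ] G) :
    opTensor a b * opTensor a' b' = opTensor (a * a') (b * b') := by
  refine opTensor_ext fun x => ?_
  change opTensor a b ∘L opTensor a' b' ∘L tmulL G x = _
  rw [opTensor_comp_tmulL, opTensor_comp_tmulL, ← ContinuousLinearMap.comp_assoc,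
    opTensor_comp_tmulL]
  rfl

/-- The rank-one operator `⟪x', ·⟫ x` tensored with `b`. -/
theorem tmulL_comp_adjoint_tmulL (x x' : K) (b : G →L[ℂ] G) :
    tmulL G x ∘L b ∘L (tmulL G x')† = opTensor (InnerProductSpace.rankOne ℂ x x') b := by
  refine opTensor_ext fun w => ?_
  rw [opTensor_comp_tmulL]
  ext y
  have h1 := DFunLike.congr_fun (adjoint_tmulL_comp_tmulL (G := G) x' w) y
  simp only [ContinuousLinearMap.comp_apply] at h1 ⊢
  rw [h1]
  rw [InnerProductSpace.rankOne_apply, tmulL_apply, tmulL_apply, ← TensorProduct.smul_tmul',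
    UniformSpace.Completion.coe_smul, smul_apply, one_apply_eq_self, map_smul,
    TensorProduct.tmul_smul, UniformSpace.Completion.coe_smul]

variable [CompleteSpace K]

theorem star_opTensor (a : K →L[ℂ] K) (b : G →L[ℂ] G) :
    star (opTensor a b) = opTensor (star a) (star b) := by
  refine opTensor_ext fun x' => ?_
  ext y'
  refine sub_eq_zero.1 (eq_zero_of_inner_tmulL fun x y => ?_)
  rw [inner_sub_right, sub_eq_zero, ContinuousLinearMap.star_eq_adjoint,
    ContinuousLinearMap.comp_apply, ContinuousLinearMap.adjoint_inner_right]
  have h1 := DFunLike.congr_fun (opTensor_comp_tmulL a b x) y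
  have h2 := DFunLike.congr_fun (opTensor_comp_tmulL (star a) (star b) x') y'
  simp only [ContinuousLinearMap.comp_apply] at h1 h2 ⊢
  rw [h1, h2, inner_tmulL_tmulL, inner_tmulL_tmulL, ContinuousLinearMap.star_eq_adjoint,
    ContinuousLinearMap.star_eq_adjoint, ContinuousLinearMap.adjoint_inner_right,
    ContinuousLinearMap.adjoint_inner_right]

theorem mem_tensor_iff {A : VonNeumannAlgebra K} {B : VonNeumannAlgebra G}
    {T : HilbertTensor K G →L[ℂ] HilbertTensor K G} :
    T ∈ tensor A B ↔ ∀ S, (∀ a ∈ A, ∀ b ∈ B, opTensor a b * S = S * opTensor a b) →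
      S * T = T * S := by
  have hstar : star {T | ∃ a ∈ A, ∃ b ∈ B, T = opTensor a b} ⊆
      {T | ∃ a ∈ A, ∃ b ∈ B, T = opTensor a b} := by
    rintro T ⟨a, ha, b, hb, hT⟩
    exact ⟨star a, star_mem ha, star b, star_mem hb, by rw [← star_opTensor, ← hT, star_star]⟩
  rw [← SetLike.mem_coe, tensor, coe_generated, Set.union_eq_self_of_subset_right hstar,
    Set.mem_centralizer_iff]
  refine forall_congr' fun S => ?_
  rw [Set.mem_centralizer_iff]
  refine imp_congr_left ⟨fun h a ha b hb => h _ ⟨a, ha, b, hb, rfl⟩, ?_⟩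
  rintro h _ ⟨a, ha, b, hb, rfl⟩
  exact h a ha b hb

theorem opTensor_mem_tensor {A : VonNeumannAlgebra K} {B : VonNeumannAlgebra G}
    {a : K →L[ℂ] K} {b : G →L[ℂ] G} (ha : a ∈ A) (hb : b ∈ B) : opTensor a b ∈ tensor A B :=
  mem_tensor_iff.2 fun _ h => (h a ha b hb).symm

end HilbertTensorOperators

section Spatial

variable {H : Type u} [NormedAddCommGroup H] [InnerProductSpace ℂ H] [CompleteSpace H]
  {A : VonNeumannAlgebra H} {P : H →L[ℂ] H} {ι : Type*} {X : ι → H →L[ℂ] H}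
  {K : Type v} [NormedAddCommGroup K] [InnerProductSpace ℂ K]
  {e : ι → K} {U : H →L[ℂ] HilbertTensor K (projSpace P)}

theorem adjoint_comp_incl_comp (i j : ι) :
    (X i ∘L incl P)† ∘L (X j ∘L incl P) = compress P (star (X i) * X j) := by
  rw [ContinuousLinearMap.adjoint_comp]
  rfl

theorem compress_self (hP : IsStarProjection P) : compress P P = 1 := by
  apply lift_injective
  rw [lift_compress hP, lift_one hP, hP.isIdempotentElem.eq, hP.isIdempotentElem.eq]

theorem total_comp_incl (hP : IsStarProjection P) (hXX : ∀ i, star (X i) * X i = P)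
    (htot : ∀ x, (∀ i, star (X i) x = 0) → x = 0) (x : H)
    (h : ∀ i, ((X i ∘L incl P)†) x = 0) : x = 0 := by
  refine htot x fun i => ?_
  have h1 : ((incl P)†) (star (X i) x) = 0 := by
    have := h i
    rwa [ContinuousLinearMap.adjoint_comp] at this
  have h2 : P * star (X i) = star (X i) := by
    have := congrArg star (mul_star_mul_self_of_star_mul_self hP (hXX i))
    rwa [star_mul, hP.isSelfAdjoint.star_eq] at this
  have h3 := DFunLike.congr_fun (incl_comp_adjoint_incl hP) (star (X i) x)
  rw [← h2, mul_apply_eq_comp, ← h3, ContinuousLinearMap.comp_apply, h1, map_zero]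

/-- The unitary from `H` to `K ⊗ PH` with `X i y ↦ e i ⊗ y` for `y ∈ PH`. -/
theorem exists_unitary (hP : IsStarProjection P) (hXX : ∀ i, star (X i) * X i = P)
    (hXne : ∀ i j, i ≠ j → star (X i) * X j = 0)
    (htot : ∀ x, (∀ i, star (X i) x = 0) → x = 0)
    (he : Orthonormal ℂ e) (hdense : Dense (Submodule.span ℂ (Set.range e) : Set K)) :
    ∃ U : H →L[ℂ] HilbertTensor K (projSpace P), U† ∘L U = 1 ∧ U ∘L U† = 1 ∧
      ∀ i, U ∘L X i ∘L incl P = tmulL (projSpace P) (e i) := by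
  have hC : ∀ i, (X i ∘L incl P)† ∘L (X i ∘L incl P) = 1 := fun i => by
    rw [adjoint_comp_incl_comp, hXX, compress_self hP]
  have hCne : ∀ i j, i ≠ j → (X i ∘L incl P)† ∘L (X j ∘L incl P) = 0 := fun i j hij => by
    rw [adjoint_comp_incl_comp, hXne i j hij]
    simp [compress]
  have hB : ∀ i, (tmulL (projSpace P) (e i))† ∘L tmulL (projSpace P) (e i) = 1 := fun i => by
    rw [adjoint_tmulL_comp_tmulL, inner_self_eq_norm_sq_to_K, he.1 i]
    simp
  have hBne : ∀ i j, i ≠ j → (tmulL (projSpace P) (e i))† ∘L tmulL (projSpace P) (e j) = 0 :=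
    fun i j hij => by rw [adjoint_tmulL_comp_tmulL, he.2 hij, zero_smul]
  have h := OrthoPartialIsometries.of_pair (B := fun i => tmulL (projSpace P) (e i))
    (C := fun i => X i ∘L incl P) hBne hCne (fun i => (hB i).trans (hC i).symm)
    (fun i => by rw [hC]; rfl)
  have h1 : ∀ i, h.sum ∘L (X i ∘L incl P) = tmulL (projSpace P) (e i) :=
    h.sum_pair_comp hCne fun i => by rw [hC]; rfl
  have h2 : ∀ i, h.sum† ∘L tmulL (projSpace P) (e i) = X i ∘L incl P :=
    h.sum_pair_adjoint_comp hBne fun i => by rw [hB]; rfl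
  refine ⟨h.sum, ?_, ?_, h1⟩
  · refine ext_of_total (total_comp_incl hP hXX htot) fun i => ?_
    rw [ContinuousLinearMap.comp_assoc, h1, h2]
    rfl
  · refine ext_of_total (L := fun i => tmulL (projSpace P) (e i))
      (fun z hz => total_tmulL hdense hz) fun i => ?_
    rw [ContinuousLinearMap.comp_assoc, h2, h1]
    rfl

variable [CompleteSpace K]

/-- Under the unitary, the commutant of `A` acts as its compression to `PH` on the second tensor
factor; hence everything in `B(K) ⊗ PAP` comes from `A'' = A`. -/
theorem conj_adjoint_mem (hP : IsProj A P) (hX : ∀ i, X i ∈ A)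
    (hXX : ∀ i, star (X i) * X i = P) (htot : ∀ x, (∀ i, star (X i) x = 0) → x = 0)
    (hU1 : U† ∘L U = 1) (hU2 : U ∘L U† = 1)
    (hU : ∀ i, U ∘L X i ∘L incl P = tmulL (projSpace P) (e i))
    {T : HilbertTensor K (projSpace P) →L[ℂ] HilbertTensor K (projSpace P)}
    (hT : T ∈ tensor (allOperators K) (cornerAlgebra A P)) : U† ∘L T ∘L U ∈ A := by
  refine mem_of_commute_commutant fun S hS => ?_
  have hSP := commute_of_mem_commutant hS hP.1
  have h1 : U ∘L S = opTensor 1 (compress P S) ∘L U := by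
    refine ext_of_total (total_comp_incl hP.2 hXX htot) fun i => ?_
    calc _ = U ∘L (S * X i) ∘L incl P := rfl
      _ = U ∘L X i ∘L (S ∘L incl P) := by rw [commute_of_mem_commutant hS (hX i)]; rfl
      _ = (U ∘L X i ∘L incl P) ∘L compress P S := by rw [comp_incl_of_commute hP.2 hSP]; rfl
      _ = opTensor 1 (compress P S) ∘L (U ∘L X i ∘L incl P) := by
          rw [hU, opTensor_comp_tmulL]; rfl
  have h2 : S ∘L U† = U† ∘L opTensor 1 (compress P S) := by
    calc _ = (U† ∘L U) ∘L S ∘L U† := by rw [hU1]; rfl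
      _ = U† ∘L (U ∘L S) ∘L U† := rfl
      _ = U† ∘L opTensor 1 (compress P S) ∘L (U ∘L U†) := by rw [h1]; rfl
      _ = _ := by rw [hU2]; rfl
  have h3 := mem_tensor_iff.1 hT (opTensor 1 (compress P S)) fun a _ b hb => by
    rw [opTensor_mul_opTensor, opTensor_mul_opTensor, mul_one, one_mul,
      mem_cornerAlgebra_iff_commute.1 hb S hS]
  calc _ = (S ∘L U†) ∘L T ∘L U := rfl
    _ = U† ∘L (opTensor 1 (compress P S) * T) ∘L U := by rw [h2]; rfl
    _ = U† ∘L T ∘L (opTensor 1 (compress P S) ∘L U) := by rw [h3]; rfl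
    _ = _ := by rw [← h1]; rfl

/-- The matrix entries `X i* T X j` of `T ∈ A` lie in `PAP`, so the image of `T` under the unitary
commutes with whatever commutes with `B(K) ⊗ PAP`. -/
theorem conj_mem_tensor (hP : IsProj A P) (hX : ∀ i, X i ∈ A)
    (he : Orthonormal ℂ e) (hdense : Dense (Submodule.span ℂ (Set.range e) : Set K))
    (hU1 : U† ∘L U = 1)
    (hU : ∀ i, U ∘L X i ∘L incl P = tmulL (projSpace P) (e i))
    {T : H →L[ℂ] H} (hT : T ∈ A) :
    U ∘L T ∘L U† ∈ tensor (allOperators K) (cornerAlgebra A P) := by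
  rw [mem_tensor_iff]
  intro S hS
  have htotal : ∀ z : HilbertTensor K (projSpace P),
      (∀ i, ((tmulL (projSpace P) (e i))†) z = 0) → z = 0 := fun z hz => total_tmulL hdense hz
  have hJ : ∀ i, (tmulL (projSpace P) (e i))† ∘L tmulL (projSpace P) (e i) = 1 := fun i => by
    rw [adjoint_tmulL_comp_tmulL, inner_self_eq_norm_sq_to_K, he.1 i]
    simp
  have hL : ∀ i, U† ∘L tmulL (projSpace P) (e i) = X i ∘L incl P := fun i => by
    rw [← hU, ← ContinuousLinearMap.comp_assoc, hU1]
    rfl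
  have hL' : ∀ i, (tmulL (projSpace P) (e i))† ∘L U = (X i ∘L incl P)† := fun i => by
    rw [← hL, ContinuousLinearMap.adjoint_comp, ContinuousLinearMap.adjoint_adjoint]
  have hunit : ∀ i j, ∀ b ∈ cornerAlgebra A P,
      (tmulL (projSpace P) (e i) ∘L b ∘L (tmulL (projSpace P) (e j))†) ∘L S =
        S ∘L tmulL (projSpace P) (e i) ∘L b ∘L (tmulL (projSpace P) (e j))† := by
    intro i j b hb
    rw [tmulL_comp_adjoint_tmulL]
    exact hS _ (mem_allOperators _) b hb
  refine commute_of_commute_entries htotal hJ (fun i => hunit i i 1 (one_mem _))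
    fun i j => hunit i j _ ?_
  have hentry : (tmulL (projSpace P) (e i))† ∘L (U ∘L T ∘L U†) ∘L tmulL (projSpace P) (e j) =
      compress P (star (X i) * T * X j) := by
    rw [ContinuousLinearMap.comp_assoc, ContinuousLinearMap.comp_assoc, hL,
      ← ContinuousLinearMap.comp_assoc, hL', ContinuousLinearMap.adjoint_comp]
    rfl
  rw [hentry]
  exact compress_mem hP (mul_mem (mul_mem (star_mem (hX i)) hT) (hX j))

/-- A central element `Z` of `PAP` is a scalar since `1 ⊗ Z` corresponds to a central element
of `A`. -/
theorem isFactor_cornerAlgebra [Nonempty ι] (hA : IsFactor A) (hP : IsProj A P)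
    (hX : ∀ i, X i ∈ A)
    (hXX : ∀ i, star (X i) * X i = P) (htot : ∀ x, (∀ i, star (X i) x = 0) → x = 0)
    (he : Orthonormal ℂ e) (hdense : Dense (Submodule.span ℂ (Set.range e) : Set K))
    (hU1 : U† ∘L U = 1) (hU2 : U ∘L U† = 1)
    (hU : ∀ i, U ∘L X i ∘L incl P = tmulL (projSpace P) (e i)) :
    IsFactor (cornerAlgebra A P) := by
  intro Z hZ hZ'
  have hmem := conj_adjoint_mem hP hX hXX htot hU1 hU2 hU
    (opTensor_mem_tensor (mem_allOperators (1 : K →L[ℂ] K)) hZ)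
  have hcomm : U† ∘L opTensor 1 Z ∘L U ∈ A.commutant := by
    rw [VonNeumannAlgebra.mem_commutant_iff]
    intro T hT
    refine commute_conj hU1 (mem_tensor_iff.1 (conj_mem_tensor hP hX he hdense hU1 hU hT) _
      fun a _ b hb => ?_)
    rw [opTensor_mul_opTensor, opTensor_mul_opTensor, mul_one, one_mul,
      commute_of_mem_commutant hZ' hb]
  obtain ⟨c, hc⟩ := hA _ hmem hcomm
  have h1 : opTensor (1 : K →L[ℂ] K) Z = c • 1 := eq_smul_one_of_conj hU2 hc
  obtain ⟨i⟩ := ‹Nonempty ι›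
  have hJ : (tmulL (projSpace P) (e i))† ∘L tmulL (projSpace P) (e i) = 1 := by
    rw [adjoint_tmulL_comp_tmulL, inner_self_eq_norm_sq_to_K, he.1 i]
    simp
  refine ⟨c, ?_⟩
  calc Z = ((tmulL (projSpace P) (e i))† ∘L tmulL (projSpace P) (e i)) ∘L Z := by rw [hJ]; rfl
    _ = (tmulL (projSpace P) (e i))† ∘L (opTensor 1 Z ∘L tmulL (projSpace P) (e i)) := by
        rw [opTensor_comp_tmulL]; rfl
    _ = c • ((tmulL (projSpace P) (e i))† ∘L tmulL (projSpace P) (e i)) := by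
        rw [h1, ContinuousLinearMap.smul_comp, ContinuousLinearMap.comp_smul]; rfl
    _ = c • 1 := by rw [hJ]

theorem unitarilyEquivalent_tensor (hP : IsProj A P) (hX : ∀ i, X i ∈ A)
    (hXX : ∀ i, star (X i) * X i = P) (htot : ∀ x, (∀ i, star (X i) x = 0) → x = 0)
    (he : Orthonormal ℂ e) (hdense : Dense (Submodule.span ℂ (Set.range e) : Set K))
    (hU1 : U† ∘L U = 1) (hU2 : U ∘L U† = 1)
    (hU : ∀ i, U ∘L X i ∘L incl P = tmulL (projSpace P) (e i)) :
    UnitarilyEquivalent A (tensor (allOperators K) (cornerAlgebra A P)) := by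
  let u : H ≃ₗᵢ[ℂ] HilbertTensor K (projSpace P) :=
    { toLinearEquiv := LinearEquiv.ofLinearMap (U : H →ₗ[ℂ] _) (U† : _ →ₗ[ℂ] H)
        (by ext x; exact DFunLike.congr_fun hU2 x) (by ext x; exact DFunLike.congr_fun hU1 x)
      norm_map' := (U.norm_map_iff_adjoint_comp_self).2 hU1 }
  refine ⟨u, ?_⟩
  have hconj : (fun T : H →L[ℂ] H => (u : H →L[ℂ] HilbertTensor K (projSpace P)) ∘L T ∘L
      (u.symm : HilbertTensor K (projSpace P) →L[ℂ] H)) = fun T => U ∘L T ∘L U† := rfl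
  rw [hconj]
  ext T
  constructor
  · rintro ⟨T, hT, rfl⟩
    exact conj_mem_tensor hP hX he hdense hU1 hU hT
  · intro hT
    exact ⟨_, conj_adjoint_mem hP hX hXX htot hU1 hU2 hU hT, conj_conj_adjoint hU2 T⟩

end Spatial

section Basis

variable {H : Type u} [NormedAddCommGroup H] [InnerProductSpace ℂ H] [CompleteSpace H]

/-- A separable Hilbert space with an orthonormal basis indexed by a given infinite orthonormal
family: the closed span of the family. -/
theorem exists_hilbertSpace_of_orthonormal [TopologicalSpace.SeparableSpace H] {ι : Type*}
    [Infinite ι] {v : ι → H} (hv : Orthonormal ℂ v) :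
    ∃ (K : Type u) (_ : NormedAddCommGroup K) (_ : InnerProductSpace ℂ K) (_ : CompleteSpace K),
      TopologicalSpace.SeparableSpace K ∧ ¬ FiniteDimensional ℂ K ∧
      ∃ e : ι → K, Orthonormal ℂ e ∧ Dense (Submodule.span ℂ (Set.range e) : Set K) := by
  set K := (Submodule.span ℂ (Set.range v)).topologicalClosure with hK
  have hvK : ∀ i, v i ∈ K := fun i =>
    Submodule.le_topologicalClosure _ (Submodule.subset_span ⟨i, rfl⟩)
  let e : ι → K := fun i => ⟨v i, hvK i⟩
  have he : Orthonormal ℂ e := ⟨fun i => hv.1 i, fun i j hij => hv.2 hij⟩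
  have := UniformSpace.secondCountable_of_separable H
  refine ⟨K, inferInstance, inferInstance,
    (Submodule.isClosed_topologicalClosure _).completeSpace_coe, inferInstance, fun hfin => ?_,
    e, he, fun z => ?_⟩
  · exact not_finite_iff_infinite.2 ‹Infinite ι› he.linearIndependent.finite
  · rw [closure_subtype]
    have himg : ((↑) : K → H) '' (Submodule.span ℂ (Set.range e) : Set K) =
        (Submodule.span ℂ (Set.range v) : Set H) := by
      rw [← Submodule.coe_subtype, ← Submodule.map_coe, Submodule.map_span, ← Set.range_comp]
      rfl
    rw [himg]
    exact z.2

end Basis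

end VNFactor

theorem mainTheorem7 {H : Type u} [NormedAddCommGroup H] [InnerProductSpace ℂ H]
    [CompleteSpace H] [TopologicalSpace.SeparableSpace H]
    (A : VonNeumannAlgebra H) (hA : VNFactor.IsFactorIIInfty A) :
    (∃ P : H →L[ℂ] H, VNFactor.IsFiniteProj A P ∧ P ≠ 0) ∧
    ∀ P : H →L[ℂ] H, VNFactor.IsFiniteProj A P → P ≠ 0 →
      ∃ N : VonNeumannAlgebra (VNFactor.projSpace P),
        (N : Set (VNFactor.projSpace P →L[ℂ] VNFactor.projSpace P)) = VNFactor.corner A P ∧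
        VNFactor.IsFactorIIOne N ∧
        ∃ (K : Type u) (_ : NormedAddCommGroup K) (_ : InnerProductSpace ℂ K)
          (_ : CompleteSpace K),
          TopologicalSpace.SeparableSpace K ∧ ¬ FiniteDimensional ℂ K ∧
          VNFactor.UnitarilyEquivalent A (VNFactor.tensor (VNFactor.allOperators K) N) := by
  refine ⟨hA.1.2.1, fun P hP hP0 => ?_⟩
  obtain ⟨m, hm, X, hX, hXX, hXne, htot⟩ := hA.1.1.exists_total_copies hA.2 hP hP0
  have : Infinite m := hm.to_subtype
  -- a unit vector in the range of `P`, whose copies index the first tensor factor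
  obtain ⟨x, hPx, hx⟩ : ∃ x, P x = x ∧ ‖x‖ = 1 := by
    obtain ⟨y, hy⟩ := DFunLike.ne_iff.1 hP0
    have hPy : P (P y) = P y := DFunLike.congr_fun hP.1.2.isIdempotentElem.eq y
    exact ⟨(‖P y‖ : ℂ)⁻¹ • P y, by rw [map_smul, hPy], norm_smul_inv_norm hy⟩
  have hinner : ∀ i j, inner ℂ (X i x) (X j x) = inner ℂ x ((star (X i) * X j) x) := fun i j =>
    (ContinuousLinearMap.adjoint_inner_right (X i) x (X j x)).symm
  have hv : Orthonormal ℂ fun i => X i x := by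
    refine ⟨fun i => ?_, fun i j hij => ?_⟩
    · have h1 := hinner i i
      rw [hXX, hPx, inner_self_eq_norm_sq_to_K, inner_self_eq_norm_sq_to_K, hx] at h1
      have h2 : ‖X i x‖ ^ 2 = 1 ^ 2 := by exact_mod_cast h1
      exact (sq_eq_sq₀ (norm_nonneg _) zero_le_one).1 h2
    · change inner ℂ (X i x) (X j x) = 0
      rw [hinner, hXne i j hij]
      simp
  obtain ⟨K, i1, i2, i3, hsep, hinf, e, he, hdense⟩ :=
    VNFactor.exists_hilbertSpace_of_orthonormal hv
  obtain ⟨U, hU1, hU2, hU⟩ := VNFactor.exists_unitary hP.1.2 hXX hXne htot he hdense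
  exact ⟨VNFactor.cornerAlgebra A P, VNFactor.coe_cornerAlgebra hP.1,
    VNFactor.isFactorIIOne_cornerAlgebra hA.1 hP hP0
      (VNFactor.isFactor_cornerAlgebra hA.1.1 hP.1 hX hXX htot he hdense hU1 hU2 hU),
    K, i1, i2, i3, hsep, hinf,
    VNFactor.unitarilyEquivalent_tensor hP.1 hX hXX htot he hdense hU1 hU2 hU⟩
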